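/- Let $\mathcal{Q}$ be a set of words on the alphabet $\{\bullet,\blacklozenge,\blacktriangle\}$ (infinite sets are allowed). Each word $w=w_1\cdots w_k\in\mathcal{Q}$ is identified with the clockwise oriented necklace carrying one $\square$-pearl followed by the pearls $w_1,\dots,w_k$. Consider finite plane trees whose vertices are copies of necklaces of $\mathcal{Q}$, whose edges join pearls of distinct vertices, each pearl being incident to at most one edge, and which are rooted at a distinguished pearl, incident to no edge. The size of a tree is its number of vertices. A rooted $\mathcal{Q}$-tree is such a tree, rooted at a $\square$-pearl, in which every edge joins a $\bullet$- or a $\blacklozenge$-pearl to a $\square$-pearl, all $\blacktriangle$-pearls are free (incident to no edge), and every other non-root pearl is incident to an edge. The excess at a pearl $x$ is the number of $\blacktriangle$-pearls minus the number of $\blacklozenge$-pearls among $x$ and the pearls on the other side of $x$ with respect to the root; the excess $\mathrm{exc}(\tau)$ of a tree $\tau$ is the excess at its root. A $\mathcal{Q}$-tree is non-negative if the excess at each pearl is non-negative. Let $\mathcal{F}_k$ be the class of non-negative $\mathcal{Q}$-trees of excess $k$, let $\mathcal{F}=\bigcup_{k\ge0}\mathcal{F}_k$, and let $F(t,u)=\sum_{\tau\in\mathcal{F}}t^{|\tau|}u^{\mathrm{exc}(\tau)}$.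 A rooted $\mathcal{Q}$-companion tree without defects is such a tree, rooted at a pearl of any kind, in which every edge joins a $\bullet$-pearl to a $\square$-pearl or a $\blacklozenge$-pearl to a $\blacktriangle$-pearl, and every non-root pearl that is not a $\square$-pearl is incident to an edge. Let $\mathbf{C}_\square,\mathbf{C}_\blacklozenge,\mathbf{C}_\blacktriangle$ be the classes of those rooted at a $\square$-, $\blacklozenge$-, $\blacktriangle$-pearl, and $C_\square,C_\blacklozenge,C_\blacktriangle$ their generating functions in $t$ with respect to size. The inverse closure of a tree of $\mathbf{C}_\square$ is obtained by growing an outgoing half-edge in the corner on the right-hand side of the edge at each $\blacklozenge$-pearl (looking away from the pearl) and an incoming half-edge at each free $\square$-pearl, and matching, iteratively, an outgoing half-edge with an incoming one whenever the latter is the next unmatched half-edge after the former in counterclockwise direction around the tree. Exactly one free $\square$-pearl remains unmatched; the tree is balanced if this pearl is its root. Let $\mathbf{B}_0$ be the class of balanced trees of $\mathbf{C}_\square$. Then there are necklace-preserving bijections (bijections that preserve the number of vertices of each necklace type, the necklaces of a pair being those of its two components together) $$\mathbf{C}_\square\;\equiv\;\mathbf{B}_0\cup(\mathbf{C}_\blacklozenge\times\mathbf{C}_\blacktriangle)\;\equiv\;\mathcal{F}_0\cup(\mathbf{C}_\blacklozenge\times\mathbf{C}_\blacktriangle),$$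 where the unions are disjoint unions. Moreover, for all $n$ and $k$ there are finitely many trees of size $n$ in $\mathcal{F}_k$, $\mathbf{C}_\square$, $\mathbf{C}_\blacklozenge$ and $\mathbf{C}_\blacktriangle$, and the generating function $f=F(t,0)$ of the non-negative $\mathcal{Q}$-trees with excess $0$ with respect to size satisfies $$f=C_\square-C_\blacklozenge\cdot C_\blacktriangle .$$ -/

import Mathlib

namespace Necklace

/-- The alphabet of pearls of which the words in `Q` are made: black bullet, red lozenge,
blue triangle. -/
inductive Letter where
  | bul
  | loz
  | tri
  deriving DecidableEq

/-- The pearls of a necklace: the square pearl, or a pearl given by a letter. -/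
inductive Pearl where
  | sq
  | letter (a : Letter)
  deriving DecidableEq

/-- The letter of a pearl; the square pearl has none. -/
def Pearl.letter? : Pearl → Option Letter
  | .sq => none
  | .letter a => some a

/-- A word `w` stands for the clockwise oriented necklace with one square pearl followed by the
pearls of `w`. Conversely, if `l` lists the pearls of such a necklace clockwise from any of its
pearls, then `necklaceWord l` is the word `w`: start at the square pearl and read the letters. -/
def necklaceWord (l : List Pearl) : List Letter :=
  (l.rotate (l.idxOf Pearl.sq)).filterMap Pearl.letter?

/-- The pearls in `l`, listed clockwise from any starting pearl, form a necklace of `Q`. -/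
def IsNecklaceOf (Q : Set (List Letter)) (l : List Pearl) : Prop :=
  l.count Pearl.sq = 1 ∧ necklaceWord l ∈ Q

mutual

/-- Pearl-rooted plane trees whose vertices are necklaces (up to isomorphism). The root vertex
is described by its root pearl, followed clockwise by its other pearls, each of them free or
incident to an edge. In a subtree, the root pearl is the one incident to the edge that leads to
the parent vertex; the root pearl of the whole tree is incident to no edge. -/
inductive PTree : Type where
  | node (root : Pearl) (bs : Branches) : PTree

/-- The non-root pearls of a vertex in clockwise order, with what they carry: nothing, or an
edge whose other end is the root pearl of a subtree. -/
inductive Branches : Type where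
  | nil : Branches
  | free (p : Pearl) (bs : Branches) : Branches
  | edge (p : Pearl) (t : PTree) (bs : Branches) : Branches

end

/-- The root pearl. -/
def PTree.root : PTree → Pearl
  | .node p _ => p

/-- The non-root pearls of the vertex itself, in clockwise order. -/
def Branches.pearls : Branches → List Pearl
  | .nil => []
  | .free p bs => p :: bs.pearls
  | .edge p _ bs => p :: bs.pearls

mutual

/-- The multiset of the necklaces (as words) at the vertices of a tree. -/
def PTree.necklaces : PTree → Multiset (List Letter)
  | .node p bs => {necklaceWord (p :: bs.pearls)} + bs.necklaces

/-- The multiset of the necklaces at the vertices of the subtrees carried by `bs`. -/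
def Branches.necklaces : Branches → Multiset (List Letter)
  | .nil => 0
  | .free _ bs => bs.necklaces
  | .edge _ t bs => t.necklaces + bs.necklaces

end

/-- The size of a tree: its number of vertices. -/
def PTree.size (t : PTree) : ℕ := Multiset.card t.necklaces

/-! ### Non-negative `Q`-trees -/

mutual

/-- Every vertex is a necklace of `Q` and is attached to its parent by its square pearl; every
edge starts at a bullet (black edge) or at a lozenge (red edge), every bullet and every lozenge
carries an edge, and the triangles are free. -/
def PTree.IsQTree (Q : Set (List Letter)) : PTree → Prop
  | .node p bs => p = .sq ∧ IsNecklaceOf Q (p :: bs.pearls) ∧ bs.IsQTree Q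

/-- The conditions of `PTree.IsQTree` at the pearls in `bs` and in the subtrees they carry. -/
def Branches.IsQTree (Q : Set (List Letter)) : Branches → Prop
  | .nil => True
  | .free p bs => p = .letter .tri ∧ bs.IsQTree Q
  | .edge p t bs => (p = .letter .bul ∨ p = .letter .loz) ∧ t.IsQTree Q ∧ bs.IsQTree Q

end

/-- Contribution of a single pearl to the excess. -/
def Pearl.excess : Pearl → ℤ
  | .letter .tri => 1
  | .letter .loz => -1
  | _ => 0

mutual

/-- The excess of a tree: its number of triangles minus its number of lozenges. -/
def PTree.excess : PTree → ℤ
  | .node p bs => p.excess + bs.excess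

/-- The number of triangles minus the number of lozenges in `bs` and the subtrees it carries. -/
def Branches.excess : Branches → ℤ
  | .nil => 0
  | .free p bs => p.excess + bs.excess
  | .edge p t bs => p.excess + t.excess + bs.excess

end

mutual

/-- The excess is non-negative at each pearl, where the excess at a pearl `x` is the number of
triangles minus the number of lozenges among `x` and the pearls beyond `x` (seen from the
root). -/
def PTree.NonNeg : PTree → Prop
  | .node p bs => 0 ≤ (PTree.node p bs).excess ∧ bs.NonNeg

/-- The excess is non-negative at each pearl of `bs` and of the subtrees it carries. -/
def Branches.NonNeg : Branches → Prop
  | .nil => True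
  | .free p bs => 0 ≤ p.excess ∧ bs.NonNeg
  | .edge p t bs => 0 ≤ p.excess + t.excess ∧ t.NonNeg ∧ bs.NonNeg

end

/-- The class `F_k` of non-negative `Q`-trees with excess `k`. -/
def F (Q : Set (List Letter)) (k : ℕ) : Set PTree :=
  {t | t.IsQTree Q ∧ t.NonNeg ∧ t.excess = k}

/-! ### `Q`-companion trees -/

/-- The two ends of an edge of a companion tree: a bullet and a square (black edge), or a
lozenge and a triangle (blue edge). -/
def Pearl.Joins (p q : Pearl) : Prop :=
  (p = .letter .bul ∧ q = .sq) ∨ (p = .sq ∧ q = .letter .bul) ∨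
  (p = .letter .loz ∧ q = .letter .tri) ∨ (p = .letter .tri ∧ q = .letter .loz)

mutual

/-- Rooted `Q`-companion trees (rooted at a pearl of any kind): every vertex is a necklace of
`Q`, the edges are black or blue, and apart from the root pearl only squares and triangles may
be free. -/
def PTree.IsCompanion (Q : Set (List Letter)) : PTree → Prop
  | .node p bs => IsNecklaceOf Q (p :: bs.pearls) ∧ bs.IsCompanion Q

/-- The conditions of `PTree.IsCompanion` at the pearls in `bs` and in the subtrees they
carry. -/
def Branches.IsCompanion (Q : Set (List Letter)) : Branches → Prop
  | .nil => True
  | .free p bs => (p = .sq ∨ p = .letter .tri) ∧ bs.IsCompanion Q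
  | .edge p t bs => p.Joins t.root ∧ t.IsCompanion Q ∧ bs.IsCompanion Q

end

mutual

/-- There is no defect, that is, no free triangle other than the root pearl. -/
def PTree.NoDefect : PTree → Prop
  | .node _ bs => bs.NoDefect

/-- There is no defect in `bs` and in the subtrees it carries. -/
def Branches.NoDefect : Branches → Prop
  | .nil => True
  | .free p bs => p ≠ .letter .tri ∧ bs.NoDefect
  | .edge _ t bs => t.NoDefect ∧ bs.NoDefect

end

/-- The class of `Q`-companion trees without defects whose root pearl is `p`. -/
def C (Q : Set (List Letter)) (p : Pearl) : Set PTree :=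
  {t | t.IsCompanion Q ∧ t.NoDefect ∧ t.root = p}

/-! ### The inverse closure and balanced trees

A counterclockwise walk around a companion tree meets the right lozenge-corners (the corner on
the right-hand side of the edge of a lozenge, seen from the lozenge) and the corners at the
free squares. An outgoing half-edge `DyckStep.U` is grown in the former, an incoming half-edge
`DyckStep.D` in the latter. The walk visits the pearls of a vertex in counterclockwise order, so
it reads `Branches` from its end; it passes the right corner of a lozenge just before it follows
the edge of the lozenge away from it. -/

mutual

/-- The half-edges met in the counterclockwise walk around a subtree, from the arrival at its
root pearl to the departure from its root pearl along the edge to the parent vertex. -/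
def PTree.halfEdges : PTree → List DyckStep
  | .node p bs => bs.halfEdges ++ (if p = .letter .loz then [DyckStep.U] else [])

/-- The half-edges met at the pearls in `bs` and around the subtrees they carry. -/
def Branches.halfEdges : Branches → List DyckStep
  | .nil => []
  | .free p bs => bs.halfEdges ++ (if p = .sq then [DyckStep.D] else [])
  | .edge p t bs =>
      bs.halfEdges ++ (if p = .letter .loz then [DyckStep.U] else []) ++ t.halfEdges

end

/-- The cyclic sequence of half-edges met in the counterclockwise walk around a square-rooted
companion tree, starting with the one at the root square (position `0`). -/
def PTree.contour : PTree → List DyckStep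
  | .node _ bs => DyckStep.D :: bs.halfEdges

/-- The closure of a cyclic sequence `W` of half-edges matches the outgoing half-edge at
position `i` with the incoming half-edge at position `j`: the half-edges met after `i` and
before `j` are matched among themselves, that is, they form a well-parenthesized word. -/
def ClosureMatches (W : List DyckStep) (i j : ℕ) : Prop :=
  i < W.length ∧ ∃ (d : DyckWord) (c : List DyckStep),
    W.rotate i = DyckStep.U :: (d.toList ++ DyckStep.D :: c) ∧
    j = (i + d.toList.length + 1) % W.length

/-- A square-rooted companion tree is balanced if its root square remains unmatched in its
inverse closure (there is always exactly one free square that remains unmatched). -/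
def PTree.Balanced (t : PTree) : Prop := ∀ i, ¬ ClosureMatches t.contour i 0

/-- The class `B_0` of balanced square-rooted `Q`-companion trees without defects. -/
def B₀ (Q : Set (List Letter)) : Set PTree :=
  {t | t ∈ C Q .sq ∧ t.Balanced}

/-! ### Disjoint unions and generating functions -/

/-- The multiset of necklaces of an element of the disjoint union `A ∪ (B × B')` of classes of
trees. -/
def sumNecklaces {A B B' : Set PTree} : A ⊕ B × B' → Multiset (List Letter)
  | .inl t => t.1.necklaces
  | .inr (t, t') => t.1.necklaces + t'.1.necklaces

/-- The generating function of a class of trees with respect to the size. -/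
noncomputable def gf (S : Set PTree) : PowerSeries ℚ :=
  PowerSeries.mk fun n => (({t ∈ S | t.size = n} : Set PTree).ncard : ℚ)

/-- The generating function `F(t,u)` of non-negative `Q`-trees with respect to size and excess,
as a power series in `t` whose coefficients are power series in `u`. -/
noncomputable def gfF (Q : Set (List Letter)) : PowerSeries (PowerSeries ℚ) :=
  PowerSeries.mk fun n => PowerSeries.mk fun k =>
    (({t ∈ F Q k | t.size = n} : Set PTree).ncard : ℚ)

/-- The generating function `f = F(t,0)`. -/
noncomputable def gff (Q : Set (List Letter)) : PowerSeries ℚ :=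
  PowerSeries.map PowerSeries.constantCoeff (gfF Q)

end Necklace

namespace Necklace

/-! ### Words of marks -/

-- Read the free squares, lozenges and free triangles met in a clockwise walk around a companion
-- tree as steps +1, -1 and 0. This is the contour of the inverse closure read backwards, so a
-- matched pair becomes a free square and a later lozenge with a Dyck word between them. Each vertex
-- has exactly one square, which fixes the total height gained (`Branches.rise_word`): the marks
-- after a root square gain 0, those after a root letter gain 1.
--
-- For the first bijection, a square-rooted tree without defects is balanced exactly when the path
-- after its root never goes below 0. Otherwise the root is matched with the lozenge at the first
-- descent, and cutting the blue edge there leaves a lozenge-rooted and a triangle-rooted tree.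
-- Conversely, glue such a pair along a blue edge: its marks gain 2, so the glued lozenge has a
-- partner square, at which the tree is rerooted. Rerooting only rotates the cyclic word and
-- matching is unique on both sides, so the two operations are inverse (`exists_cutAtRoot`).
--
-- For the second bijection, companion trees with defects are admitted, provided the defects lie at
-- height 0 (`OpenTrees`). A red edge of a `Q`-tree becomes blue by rerooting the subtree hung at
-- the lozenge at the first free triangle met from its root square (`exists_reroot`). Doing this
-- from the leaves up turns the excess into the number of defects left; non-negativity says
-- precisely that a triangle is available at each lozenge. Excess 0 therefore corresponds to open
-- trees without defects, which are the balanced trees (`B₀_eq`).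
--
-- Both bijections preserve necklaces, hence sizes, and the identity of series follows by counting.

/-- The marks met in a clockwise walk around a companion tree: `up` at a free square, `down` at
a lozenge, `flat` at a free triangle. -/
inductive Mark where
  | up
  | down
  | flat
  deriving DecidableEq

/-- The height reached from `h` along a word of marks; the run fails if it goes below `0` or
meets a flat mark at a positive height. -/
def run : ℕ → List Mark → Option ℕ
  | h, [] => some h
  | h, .up :: w => run (h + 1) w
  | 0, .down :: _ => none
  | h + 1, .down :: w => run h w
  | 0, .flat :: w => run 0 w
  | _ + 1, .flat :: _ => none

theorem run_append (h : ℕ) (u v : List Mark) :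
    run h (u ++ v) = (run h u).bind fun k => run k v := by
  induction u generalizing h with
  | nil => simp [run]
  | cons e u ih => cases e <;> cases h <;> simp [run, ih]

theorem run_add {h j : ℕ} {w : List Mark} (hw : Mark.flat ∉ w) (hr : run h w = some j) (k : ℕ) :
    run (h + k) w = some (j + k) := by
  induction w generalizing h with
  | nil => simp_all [run]
  | cons e w ih =>
    cases e
    · simp only [run] at hr ⊢
      rw [add_right_comm]
      exact ih (by simp_all) hr
    · cases h
      · simp [run] at hr
      · simp only [run] at hr
        rw [add_right_comm]
        exact ih (by simp_all) hr
    · simp at hw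

/-- The height gained along a word of marks. -/
def rise : List Mark → ℤ
  | [] => 0
  | .up :: w => rise w + 1
  | .down :: w => rise w - 1
  | .flat :: w => rise w

theorem rise_append (u v : List Mark) : rise (u ++ v) = rise u + rise v := by
  induction u with
  | nil => simp [rise]
  | cons e u ih => cases e <;> simp [rise, ih] <;> ring

theorem eq_of_run_eq_some {h j : ℕ} {w : List Mark} (hr : run h w = some j) :
    (j : ℤ) = h + rise w := by
  induction w generalizing h with
  | nil => simp_all [run, rise]
  | cons e w ih =>
    cases e <;> cases h <;> simp only [run, rise, reduceCtorEq] at hr ⊢ <;> have := ih hr <;>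
      push_cast at * <;> linarith

theorem exists_run_eq_some {w : List Mark} (hw : Mark.flat ∉ w) {h : ℕ} (hh : w.length ≤ h) :
    ∃ j, run h w = some j := by
  induction w generalizing h with
  | nil => exact ⟨h, rfl⟩
  | cons e w ih =>
    simp only [List.mem_cons, not_or, List.length_cons] at hw hh
    cases e
    · exact ih hw.2 (by omega)
    · obtain ⟨h, rfl⟩ : ∃ k, h = k + 1 := ⟨h - 1, by omega⟩
      exact ih hw.2 (by omega)
    · exact absurd rfl hw.1

/-- Words of up and down marks that are well parenthesized. -/
def IsDyck (w : List Mark) : Prop := run 0 w = some 0 ∧ Mark.flat ∉ w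

theorem IsDyck.run_eq {w : List Mark} (hw : IsDyck w) (h : ℕ) : run h w = some h := by
  simpa using run_add hw.2 hw.1 h

theorem isDyck_nil : IsDyck [] := ⟨rfl, by simp⟩

theorem not_isDyck_append_down {u : List Mark} (hu : IsDyck u) (v : List Mark) :
    ¬ IsDyck (u ++ .down :: v) := by
  rintro ⟨h, -⟩
  simp [run_append, hu.1, run] at h

theorem not_isDyck_append_up {u : List Mark} (hu : IsDyck u) (v : List Mark) :
    ¬ IsDyck (v ++ .up :: u) := by
  rintro ⟨h, -⟩
  rw [run_append] at h
  cases hv : run 0 v with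
  | none => simp [hv] at h
  | some k => simp [hv, run, hu.run_eq] at h

/-- Decomposition at the last passage. -/
theorem exists_last_up {h k : ℕ} {w : List Mark} (hr : run h w = some (k + 1)) (hk : h ≤ k) :
    ∃ v u, w = v ++ .up :: u ∧ run h v = some k ∧ IsDyck u := by
  induction hn : w.length using Nat.strong_induction_on generalizing w k with
  | _ n ih =>
  subst hn
  rcases List.eq_nil_or_concat w with rfl | ⟨w', e, rfl⟩
  · simp [run] at hr; omega
  · simp only [List.concat_eq_append] at *
    rw [run_append] at hr
    cases hw' : run h w' with
    | none => simp [hw'] at hr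
    | some j =>
      simp only [hw', Option.bind_some] at hr
      cases e
      · simp only [run, Option.some.injEq, add_left_inj] at hr
        subst hr
        exact ⟨w', [], rfl, hw', isDyck_nil⟩
      · cases j with
        | zero => simp [run] at hr
        | succ j =>
          simp only [run, Option.some.injEq] at hr
          subst hr
          -- The path stands at `k + 2` before the final descent: peel off the last rise to `k + 2`,
          -- then the last rise to `k + 1`. The final descent closes the former.
          obtain ⟨v, u, rfl, hv, hu⟩ := ih _ (by simp) hw' (by omega) rfl
          obtain ⟨v₁, u₁, rfl, hv₁, hu₁⟩ := ih _ (by simp) hv hk rfl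
          refine ⟨v₁, u₁ ++ .up :: (u ++ [.down]), by simp, hv₁, ?_, ?_⟩
          · simp [run_append, hu₁.1, run, hu.run_eq]
          · simp [hu₁.2, hu.2]
      · cases j <;> simp [run] at hr

theorem exists_last_up_of_rise_pos {w : List Mark} (hw : Mark.flat ∉ w) (hr : 0 < rise w) :
    ∃ v u, w = v ++ .up :: u ∧ IsDyck u := by
  -- Starting at height `w.length` the path cannot go below 0, so the last-passage decomposition
  -- applies although `w` itself may descend below its start.
  obtain ⟨j, hj⟩ := exists_run_eq_some hw le_rfl
  have h1 := eq_of_run_eq_some hj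
  obtain ⟨k, rfl⟩ : ∃ k, j = k + 1 := ⟨j - 1, by omega⟩
  obtain ⟨v, u, h, -, hu⟩ := exists_last_up hj (by omega)
  exact ⟨v, u, h, hu⟩

/-- Decomposition at the first passage below `0`. -/
theorem exists_first_down {w : List Mark} (hw : Mark.flat ∉ w) (hr : run 0 w = none) :
    ∃ u v, w = u ++ .down :: v ∧ IsDyck u := by
  induction w using List.reverseRecOn with
  | nil => simp [run] at hr
  | append_singleton w e ih =>
    simp only [List.mem_append, not_or] at hw
    cases hw' : run 0 w with
    | none =>
      obtain ⟨u, v, rfl, hu⟩ := ih hw.1 hw'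
      exact ⟨u, v ++ [e], by simp, hu⟩
    | some j =>
      rw [run_append, hw', Option.bind_some] at hr
      cases e
      · simp [run] at hr
      · cases j with
        | zero => exact ⟨w, [], rfl, hw', hw.1⟩
        | succ j => simp [run] at hr
      · simp at hw

theorem exists_first_flat {w : List Mark} (hr : run 0 w = some 0) (hw : Mark.flat ∈ w) :
    ∃ u v, w = u ++ .flat :: v ∧ IsDyck u ∧ run 0 v = some 0 := by
  obtain ⟨u, v, rfl, hu⟩ : ∃ u v, w = u ++ Mark.flat :: v ∧ Mark.flat ∉ u := by
    obtain ⟨u, v, h, h'⟩ := List.eq_append_cons_of_mem hw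
    exact ⟨u, v, h, h'⟩
  refine ⟨u, v, rfl, ?_⟩
  rw [run_append] at hr
  cases hj : run 0 u with
  | none => simp [hj] at hr
  | some j => cases j <;> simp_all [run, IsDyck]

/-- With no net gain over `u`, a run surviving `u` is back at 0, so `v` starts afresh. This is what
lets conditions on a tree split over its subtrees. -/
theorem run_append_eq_zero_iff {u v : List Mark} (hu : rise u = 0) :
    run 0 (u ++ v) = some 0 ↔ run 0 u = some 0 ∧ run 0 v = some 0 := by
  rw [run_append]
  cases hj : run 0 u with
  | none => simp
  | some j =>
    have := eq_of_run_eq_some hj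
    obtain rfl : j = 0 := by simp_all
    simp

theorem run_eq_zero_iff_of_down {w : List Mark} :
    run 0 (w ++ [.down]) = some 0 ↔ ∃ v u, w = v ++ .up :: u ∧ run 0 v = some 0 ∧ IsDyck u := by
  constructor
  · intro h
    refine exists_last_up (k := 0) ?_ le_rfl
    rw [run_append] at h
    cases hj : run 0 w with
    | none => simp [hj] at h
    | some j => rcases j with _ | j <;> simp_all [run]
  · rintro ⟨v, u, rfl, hv, hu⟩
    simp [run_append, hv, run, hu.run_eq]

/-! ### The walk around a tree -/

theorem Branches.ind {P : Branches → Prop} (nil : P .nil) (free : ∀ p bs, P bs → P (.free p bs))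
    (edge : ∀ p q bs' bs, P bs' → P bs → P (.edge p (.node q bs') bs)) (b : Branches) : P b :=
  Branches.rec (motive_1 := fun t => ∀ p bs, P bs → P (.edge p t bs)) (motive_2 := P)
    (fun q bs' h p bs => edge p q bs' bs h) nil free (fun p _ bs h h' => h p bs h') b

/-- Concatenation of branches. -/
def Branches.append : Branches → Branches → Branches
  | .nil, a => a
  | .free p bs, a => .free p (bs.append a)
  | .edge p t bs, a => .edge p t (bs.append a)

instance : Append Branches := ⟨Branches.append⟩

namespace Branches

@[simp] theorem nil_append (a : Branches) : nil ++ a = a := rfl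
@[simp] theorem free_append (p : Pearl) (bs a : Branches) :
    free p bs ++ a = free p (bs ++ a) := rfl
@[simp] theorem edge_append (p : Pearl) (t : PTree) (bs a : Branches) :
    edge p t bs ++ a = edge p t (bs ++ a) := rfl

@[simp] theorem append_nil (a : Branches) : a ++ nil = a := by
  induction a using ind <;> simp_all

theorem append_assoc (a b c : Branches) : a ++ b ++ c = a ++ (b ++ c) := by
  induction a using ind <;> simp_all

end Branches

/-- The mark at a free pearl. -/
def Pearl.freeMark : Pearl → List Mark
  | .sq => [.up]
  | .letter .tri => [.flat]
  | _ => []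

/-- The mark at a pearl incident to an edge. -/
def Pearl.edgeMark : Pearl → List Mark
  | .letter .loz => [.down]
  | _ => []

mutual

/-- The marks met in a clockwise walk around a subtree. -/
def PTree.word : PTree → List Mark
  | .node q bs => q.edgeMark ++ bs.word

/-- The marks met in a clockwise walk around branches. -/
def Branches.word : Branches → List Mark
  | .nil => []
  | .free p bs => p.freeMark ++ bs.word
  | .edge p t bs => t.word ++ (p.edgeMark ++ bs.word)

end

mutual

/-- The number of pearls and subtrees met in a walk around a subtree. -/
def PTree.steps : PTree → ℕ
  | .node _ bs => bs.steps + 1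

/-- The number of steps of a clockwise walk around branches. -/
def Branches.steps : Branches → ℕ
  | .nil => 0
  | .free _ bs => bs.steps + 1
  | .edge _ t bs => t.steps + 1 + bs.steps

end

namespace Branches

/-- Consider branches as a vertex cut open at a corner. The clockwise walk passes the first pearl
if it is free, and follows its edge otherwise. -/
def walk : Branches → Branches
  | nil => nil
  | free p bs => bs ++ free p nil
  | edge p (.node q bs') bs => bs' ++ edge q (.node p bs) nil

/-- The mark met in one step of the clockwise walk. -/
def mark : Branches → List Mark
  | nil => []
  | free p _ => p.freeMark
  | edge _ t _ => t.root.edgeMark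

/-- The marks met in `n` steps of the clockwise walk. -/
def trace : ℕ → Branches → List Mark
  | 0, _ => []
  | n + 1, b => b.mark ++ trace n b.walk

theorem iterate_walk_add (m n : ℕ) (b : Branches) :
    walk^[m + n] b = walk^[n] (walk^[m] b) := by
  rw [add_comm, Function.iterate_add_apply]

theorem trace_add (m n : ℕ) (b : Branches) :
    trace (m + n) b = trace m b ++ trace n (walk^[m] b) := by
  induction m generalizing b with
  | zero => simp [trace]
  | succ m ih => simp [Nat.succ_add, trace, ih]

theorem word_append (a b : Branches) : (a ++ b).word = a.word ++ b.word := by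
  induction a using ind <;> simp_all [word]

theorem steps_append (a b : Branches) : (a ++ b).steps = a.steps + b.steps := by
  induction a using ind <;> simp_all [steps] <;> omega

/-- The part `c` is traversed and comes to lie behind the untouched part `a`. The induction needs
arbitrary `a`, because the rest of the tree changes its shape during the walk. -/
theorem walk_around (c a : Branches) :
    trace c.steps (c ++ a) = c.word ∧ walk^[c.steps] (c ++ a) = a ++ c := by
  induction c using ind generalizing a with
  | nil => simp [steps, trace, word]
  | free p bs ih =>
    simpa [steps, trace, word, mark, walk, append_assoc] using ih (a ++ free p nil)
  | edge p q bs' bs ih' ih =>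
    -- During the walk around `bs'`, the child is the current vertex and the rest of the parent
    -- hangs from it as a subtree at `q`.
    have h1 := ih' (edge q (.node p (bs ++ a)) nil)
    have h2 := ih (a ++ edge p (.node q bs') nil)
    have e : (edge p (.node q bs') bs).steps = 1 + (bs'.steps + (1 + bs.steps)) := by
      simp [steps, PTree.steps]; ring
    rw [e, trace_add, trace_add, trace_add, iterate_walk_add, iterate_walk_add, iterate_walk_add]
    simp [trace, word, PTree.word, mark, walk, h1, h2, PTree.root, append_assoc]

theorem trace_steps (b : Branches) : trace b.steps b = b.word := by
  simpa using (walk_around b nil).1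

theorem iterate_walk_steps (b : Branches) : walk^[b.steps] b = b := by
  simpa using (walk_around b nil).2

theorem steps_walk (b : Branches) : b.walk.steps = b.steps := by
  rcases b with _ | ⟨p, bs⟩ | ⟨p, ⟨q, bs'⟩, bs⟩ <;> simp [walk, steps, PTree.steps, steps_append]
  ring

theorem eq_nil_of_steps_eq_zero {b : Branches} (h : b.steps = 0) : b = nil := by
  rcases b with _ | ⟨p, bs⟩ | ⟨p, t, bs⟩ <;> simp [steps] at h ⊢

/-- A full turn is the identity and its length is invariant under a step, so continuing from the
common image recovers both starting points. -/
theorem walk_injective : Function.Injective walk := by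
  intro x y h
  have hs : x.steps = y.steps := by rw [← steps_walk x, ← steps_walk y, h]
  rcases hx : x.steps with _ | n
  · rw [eq_nil_of_steps_eq_zero hx, eq_nil_of_steps_eq_zero (hs.symm.trans hx)]
  · rw [← iterate_walk_steps x, ← iterate_walk_steps y, ← hs, hx]
    simp [h]

theorem exists_word_eq_mark_append (b : Branches) :
    ∃ r, b.word = b.mark ++ r ∧ b.walk.word = r ++ b.mark := by
  rcases b with _ | ⟨p, bs⟩ | ⟨p, ⟨q, bs'⟩, bs⟩
  · exact ⟨[], rfl, rfl⟩
  · exact ⟨bs.word, rfl, by simp [walk, word_append, word, mark]⟩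
  · exact ⟨bs'.word ++ (p.edgeMark ++ bs.word), by simp [word, PTree.word, mark, PTree.root],
      by simp [walk, word_append, word, PTree.word, mark, PTree.root]⟩

theorem word_iterate_walk {n : ℕ} {b : Branches} {s : List Mark} (h : b.word = trace n b ++ s) :
    (walk^[n] b).word = s ++ trace n b := by
  induction n generalizing b s with
  | zero => simpa [trace] using h
  | succ n ih =>
    obtain ⟨r, h1, h2⟩ := exists_word_eq_mark_append b
    simp only [trace, h1, List.append_assoc, List.append_cancel_left_eq] at h
    have := ih (b := b.walk) (s := s ++ b.mark) (by rw [h2, h]; simp)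
    simpa [trace] using this

theorem length_mark_le (b : Branches) : b.mark.length ≤ 1 := by
  have hf (p : Pearl) : p.freeMark.length ≤ 1 := by
    rcases p with _ | (_ | _ | _) <;> simp [Pearl.freeMark]
  have he (p : Pearl) : p.edgeMark.length ≤ 1 := by
    rcases p with _ | (_ | _ | _) <;> simp [Pearl.edgeMark]
  rcases b with _ | ⟨p, bs⟩ | ⟨p, t, bs⟩ <;> simp [mark, hf, he]

/-- A step yields at most one mark, so any splitting of the word at a letter comes from a splitting
of the walk. -/
theorem exists_of_trace_eq {N : ℕ} {b : Branches} {u v : List Mark} {e : Mark}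
    (h : trace N b = u ++ e :: v) :
    ∃ n m, N = n + 1 + m ∧ trace n b = u ∧ (walk^[n] b).mark = [e] ∧
      trace m (walk^[n + 1] b) = v := by
  induction N generalizing b u with
  | zero => simp [trace] at h
  | succ N ih =>
    have hl := length_mark_le b
    rcases hm : b.mark with _ | ⟨e', l⟩
    · simp only [trace, hm, List.nil_append] at h
      obtain ⟨n, m, rfl, h1, h2, h3⟩ := ih h
      exact ⟨n + 1, m, by ring, by simp [trace, hm, h1], h2, h3⟩
    · obtain rfl : l = [] := by simpa [hm] using hl
      simp only [trace, hm, List.cons_append, List.nil_append] at h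
      rcases u with _ | ⟨e'', u⟩
      · simp only [List.nil_append, List.cons.injEq] at h
        exact ⟨0, N, by ring, rfl, by simp [hm, h.1], by simpa using h.2⟩
      · simp only [List.cons_append, List.cons.injEq] at h
        obtain ⟨n, m, rfl, h1, h2, h3⟩ := ih h.2
        exact ⟨n + 1, m, by ring, by simp [trace, hm, h1, h.1], h2, h3⟩

/-- The free square `x` is matched with the lozenge or free triangle `y` in a clockwise walk. -/
def Matched (x y : Branches) : Prop :=
  x.mark = [.up] ∧ (∃ e, e ≠ .up ∧ y.mark = [e]) ∧
    ∃ n, walk^[n] x.walk = y ∧ IsDyck (trace n x.walk)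

theorem not_isDyck_append_cons {u : List Mark} (hu : IsDyck u) {e : Mark} (he : e ≠ .up)
    (v : List Mark) : ¬ IsDyck (u ++ e :: v) := by
  cases e
  · exact absurd rfl he
  · exact not_isDyck_append_down hu v
  · intro h
    simpa using h.2

/-- A Dyck word followed by a mark other than `up` is never a prefix of a Dyck word, so the shorter
of the two walks cannot be strictly shorter. -/
theorem Matched.right_unique {x y y' : Branches} (h : Matched x y) (h' : Matched x y') :
    y = y' := by
  have key {m n : ℕ} {b : Branches} (hm : IsDyck (trace m b)) (hn : IsDyck (trace n b))
      (he : ∃ e, e ≠ .up ∧ (walk^[m] b).mark = [e]) : ¬ m < n := by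
    intro hmn
    obtain ⟨k, rfl⟩ : ∃ k, n = m + (k + 1) := ⟨n - m - 1, by omega⟩
    obtain ⟨e, he, hme⟩ := he
    rw [trace_add, trace, hme] at hn
    exact not_isDyck_append_cons hm he _ hn
  obtain ⟨-, he, n, rfl, hn⟩ := h
  obtain ⟨-, he', n', rfl, hn'⟩ := h'
  rw [le_antisymm (not_lt.1 (key hn' hn he')) (not_lt.1 (key hn hn' he))]

theorem Matched.left_unique {x x' y : Branches} (h : Matched x y) (h' : Matched x' y) :
    x = x' := by
  obtain ⟨hx, -, n, hn, hd⟩ := h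
  obtain ⟨hx', -, n', hn', hd'⟩ := h'
  wlog hle : n ≤ n' generalizing x x' n n'
  · exact (this hx' n' hn' hd' hx n hn hd (le_of_not_ge hle)).symm
  obtain ⟨k, rfl⟩ := Nat.exists_eq_add_of_le' hle
  rw [← hn, iterate_walk_add] at hn'
  have hk := walk_injective.iterate n hn'
  cases k with
  | zero => exact (walk_injective hk).symm
  | succ k =>
    -- The longer walk passes through `x`, so its Dyck word would end in `up` followed by a Dyck
    -- word.
    rw [Function.iterate_succ_apply'] at hk
    have hk' := walk_injective hk
    rw [trace_add, trace_add, hk', Function.iterate_succ_apply', hk'] at hd'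
    simp only [trace, hx, List.append_assoc, List.append_nil, List.cons_append,
      List.nil_append] at hd'
    exact absurd hd' (not_isDyck_append_up hd _)

theorem exists_matched_right {x : Branches} {u v : List Mark} {e : Mark} (hx : x.mark = [.up])
    (hw : x.word = .up :: (u ++ e :: v)) (hu : IsDyck u) (he : e ≠ .up) :
    ∃ y, Matched x y ∧ y.mark = [e] ∧ y.word = e :: (v ++ .up :: u) ∧ ∃ n, walk^[n] x = y := by
  have ht := trace_steps x
  rw [hw, ← List.cons_append] at ht
  obtain ⟨n, m, hs, h1, h2, h3⟩ := exists_of_trace_eq ht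
  have hy := word_iterate_walk (n := n) (b := x) (s := e :: v) (by rw [h1, hw]; simp)
  rw [h1] at hy
  cases n with
  | zero => simp [trace] at h1
  | succ n =>
    simp only [trace, hx, List.cons_append, List.nil_append, List.cons.injEq, true_and] at h1
    exact ⟨_, ⟨hx, ⟨e, he, h2⟩, n, rfl, h1 ▸ hu⟩, h2, hy, n + 1, rfl⟩

theorem exists_matched_left {y : Branches} {u v : List Mark} {e : Mark} (hy : y.mark = [e])
    (hw : y.word = e :: (v ++ .up :: u)) (hu : IsDyck u) (he : e ≠ .up) :
    ∃ x, Matched x y ∧ x.mark = [.up] ∧ x.word = .up :: (u ++ e :: v) ∧ ∃ n, walk^[n] y = x := by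
  have ht := trace_steps y
  rw [hw, ← List.cons_append] at ht
  obtain ⟨n, m, hs, h1, h2, h3⟩ := exists_of_trace_eq ht
  have hx := word_iterate_walk (n := n) (b := y) (s := .up :: u) (by rw [h1, hw]; simp)
  rw [h1] at hx
  refine ⟨_, ⟨h2, ⟨e, he, hy⟩, m, ?_, ?_⟩, h2, by simpa using hx, n, rfl⟩
  -- The `m` steps left after passing `x` complete the turn and return to `y`.
  · rw [← Function.iterate_succ_apply' walk, ← iterate_walk_add, ← hs, iterate_walk_steps]
  · rw [← Function.iterate_succ_apply' walk, h3]
    exact hu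

end Branches

/-! ### Invariance under the walk -/

theorem necklaceWord_append_sq {u : List Pearl} (hu : Pearl.sq ∉ u) (v : List Pearl) :
    necklaceWord (u ++ .sq :: v) = (v ++ u).filterMap Pearl.letter? := by
  have h : (u ++ Pearl.sq :: v).idxOf Pearl.sq = u.length := by
    simp [List.idxOf_append_of_notMem hu]
  rw [necklaceWord, h, List.rotate_append_length_eq]
  simp [List.filterMap_cons, Pearl.letter?]

theorem necklaceWord_append_singleton {p : Pearl} {l : List Pearl}
    (h : (p :: l).count .sq = 1) : necklaceWord (l ++ [p]) = necklaceWord (p :: l) := by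
  by_cases hp : p = .sq
  · subst hp
    have hl : Pearl.sq ∉ l := by simpa [List.count_eq_zero] using h
    rw [necklaceWord_append_sq hl]
    simpa using (necklaceWord_append_sq (u := []) (by simp) l).symm
  · have hl : Pearl.sq ∈ l := by
      rw [List.count_cons_of_ne hp] at h
      exact List.count_pos_iff.1 (by omega)
    obtain ⟨u, v, rfl, hu⟩ := List.eq_append_cons_of_mem hl
    have h1 := necklaceWord_append_sq (u := p :: u) (by simp [hu, Ne.symm hp]) v
    have h2 := necklaceWord_append_sq hu (v ++ [p])
    simp only [List.cons_append] at h1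
    simp [h1, h2]

theorem IsNecklaceOf.append_singleton {Q : Set (List Letter)} {p : Pearl} {l : List Pearl}
    (h : IsNecklaceOf Q (p :: l)) : IsNecklaceOf Q (l ++ [p]) := by
  refine ⟨?_, ?_⟩
  · rw [← h.1]
    exact (List.perm_append_singleton p l).count_eq _
  · rw [necklaceWord_append_singleton h.1]
    exact h.2

theorem Pearl.Joins.symm {p q : Pearl} (h : p.Joins q) : q.Joins p := by
  unfold Pearl.Joins at *
  tauto

namespace Branches

theorem pearls_append (a b : Branches) : (a ++ b).pearls = a.pearls ++ b.pearls := by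
  induction a using ind <;> simp_all [pearls]

theorem necklaces_append (a b : Branches) :
    (a ++ b).necklaces = a.necklaces + b.necklaces := by
  induction a using ind <;> simp_all [necklaces, add_assoc]

theorem isCompanion_append {Q : Set (List Letter)} (a b : Branches) :
    (a ++ b).IsCompanion Q ↔ a.IsCompanion Q ∧ b.IsCompanion Q := by
  induction a using ind <;> simp_all [IsCompanion, and_assoc]

/-- The branches form a vertex, cut open at a corner, of a companion tree. -/
def IsVertex (Q : Set (List Letter)) (b : Branches) : Prop :=
  IsNecklaceOf Q b.pearls ∧ b.IsCompanion Q

/-- The necklaces of the tree with a given vertex, cut open at a corner. -/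
def allNecklaces (b : Branches) : Multiset (List Letter) :=
  {necklaceWord b.pearls} + b.necklaces

theorem IsVertex.walk {Q : Set (List Letter)} {b : Branches} (h : b.IsVertex Q) :
    b.walk.IsVertex Q := by
  rcases b with _ | ⟨p, bs⟩ | ⟨p, ⟨q, bs'⟩, bs⟩
  · exact h
  · obtain ⟨h1, h2, h3⟩ := h
    refine ⟨?_, ?_⟩
    · simpa [Branches.walk, pearls_append, pearls] using h1.append_singleton
    · exact (isCompanion_append _ _).2 ⟨h3, h2, trivial⟩
  · obtain ⟨h1, h2, ⟨h3, h4⟩, h5⟩ := h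
    refine ⟨?_, ?_⟩
    · simpa [Branches.walk, pearls_append, pearls] using h3.append_singleton
    · exact (isCompanion_append _ _).2 ⟨h4, h2.symm, ⟨h1, h5⟩, trivial⟩

theorem IsVertex.allNecklaces_walk {Q : Set (List Letter)} {b : Branches} (h : b.IsVertex Q) :
    b.walk.allNecklaces = b.allNecklaces := by
  rcases b with _ | ⟨p, bs⟩ | ⟨p, ⟨q, bs'⟩, bs⟩
  · rfl
  · have := necklaceWord_append_singleton h.1.1
    simp_all [Branches.walk, allNecklaces, pearls_append, necklaces_append, pearls, necklaces]
  · obtain ⟨h1, h2, ⟨h3, h4⟩, h5⟩ := h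
    have := necklaceWord_append_singleton h3.1
    simp_all only [Branches.walk, allNecklaces, pearls_append, necklaces_append, pearls, necklaces,
      PTree.necklaces]
    abel

theorem IsVertex.iterate_walk {Q : Set (List Letter)} {b : Branches} (h : b.IsVertex Q) (n : ℕ) :
    (Branches.walk^[n] b).IsVertex Q ∧
      (Branches.walk^[n] b).allNecklaces = b.allNecklaces := by
  induction n generalizing b with
  | zero => exact ⟨h, rfl⟩
  | succ n ih => simpa [h.allNecklaces_walk] using ih h.walk

theorem exists_free_sq {x : Branches} (h : x.mark = [.up]) : ∃ bs, x = free .sq bs := by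
  rcases x with _ | ⟨_ | _ | _ | _, bs⟩ | ⟨p, ⟨_ | _ | _ | _, bs'⟩, bs⟩ <;>
    simp [mark, Pearl.freeMark, Pearl.edgeMark, PTree.root] at h ⊢

theorem exists_free_tri {x : Branches} (h : x.mark = [.flat]) :
    ∃ bs, x = free (.letter .tri) bs := by
  rcases x with _ | ⟨_ | _ | _ | _, bs⟩ | ⟨p, ⟨_ | _ | _ | _, bs'⟩, bs⟩ <;>
    simp [mark, Pearl.freeMark, Pearl.edgeMark, PTree.root] at h ⊢

theorem IsVertex.exists_edge_tri {Q : Set (List Letter)} {x : Branches} (hx : x.IsVertex Q)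
    (h : x.mark = [.down]) :
    ∃ bs bs', x = edge (.letter .tri) (.node (.letter .loz) bs') bs := by
  rcases x with _ | ⟨_ | _ | _ | _, bs⟩ | ⟨p, ⟨_ | _ | _ | _, bs'⟩, bs⟩ <;>
    simp [mark, Pearl.freeMark, Pearl.edgeMark, PTree.root] at h ⊢
  have := hx.2.1
  simpa [Pearl.Joins, PTree.root] using this

/-- Each vertex has one square, so a subtree together with the pearl `p` carrying it gains 1 if `p`
is the square (the child is rooted at a bullet) and 0 otherwise: on a blue edge the gain 1 of the
child's branches is cancelled by the mark of the lozenge, whichever end it is. -/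
theorem rise_word {Q : Set (List Letter)} {b : Branches} (h : b.IsCompanion Q) :
    rise b.word = b.pearls.count .sq := by
  induction b using ind with
  | nil => rfl
  | free p bs ih =>
    obtain ⟨rfl | rfl, h⟩ := h <;>
      simp [word, pearls, Pearl.freeMark, rise, ih h]
  | edge p q bs' bs ih' ih =>
    obtain ⟨hj, ⟨hn, h'⟩, h⟩ := h
    have hc := hn.1
    simp only [word, PTree.word, rise_append, ih h, ih' h', pearls]
    rcases hj with ⟨rfl, rfl⟩ | ⟨rfl, rfl⟩ | ⟨rfl, rfl⟩ | ⟨rfl, rfl⟩ <;>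
      simp_all [Pearl.edgeMark, rise]
    omega

end Branches

theorem rise_word_of_sq {Q : Set (List Letter)} {bs : Branches}
    (h : (PTree.node .sq bs).IsCompanion Q) : rise bs.word = 0 := by
  rw [Branches.rise_word h.2]
  simpa using h.1.1

theorem rise_word_of_letter {Q : Set (List Letter)} {bs : Branches} {a : Letter}
    (h : (PTree.node (.letter a) bs).IsCompanion Q) : rise bs.word = 1 := by
  rw [Branches.rise_word h.2]
  simpa using h.1.1

theorem isVertex_free_iff {Q : Set (List Letter)} {bs : Branches} {p : Pearl}
    (hp : p = .sq ∨ p = .letter .tri) :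
    (Branches.free p bs).IsVertex Q ↔ (PTree.node p bs).IsCompanion Q := by
  simp [Branches.IsVertex, Branches.IsCompanion, PTree.IsCompanion, Branches.pearls, hp]

/-- The bijection given by a relation that is bijective between two classes. -/
theorem exists_bijOn_of_rel {α β : Type*} [Nonempty β] {A : Set α} {B : Set β} (R : α → β → Prop)
    (hA : ∀ a ∈ A, ∃ b ∈ B, R a b) (hB : ∀ b ∈ B, ∃ a ∈ A, R a b)
    (hr : ∀ a b b', R a b → R a b' → b = b') (hl : ∀ a a' b, R a b → R a' b → a = a') :
    ∃ f : α → β, Set.BijOn f A B ∧ ∀ a ∈ A, R a (f a) := by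
  have h (a : α) : ∃ b, a ∈ A → b ∈ B ∧ R a b := by
    by_cases ha : a ∈ A
    · obtain ⟨b, hb, hR⟩ := hA a ha
      exact ⟨b, fun _ => ⟨hb, hR⟩⟩
    · exact ⟨Classical.arbitrary β, fun h => absurd h ha⟩
  choose f hf using h
  refine ⟨f, ⟨fun a ha => (hf a ha).1, fun a ha a' ha' e => ?_, fun b hb => ?_⟩,
    fun a ha => (hf a ha).2⟩
  · exact hl _ _ _ (hf a ha).2 (e ▸ (hf a' ha').2)
  · obtain ⟨a, ha, h⟩ := hB b hb
    exact ⟨a, ha, hr _ _ _ (hf a ha).2 h⟩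

/-! ### Rerooting -/

instance : Nonempty PTree := ⟨.node .sq .nil⟩

/-- The number of defects of a tree: its free triangles other than the root pearl. -/
def PTree.defects (t : PTree) : ℕ := t.word.count .flat

/-- The class of square-rooted companion trees, possibly with defects, in which the root square
is not matched, and in which the defects are not enclosed by matched half-edges. -/
def OpenTrees (Q : Set (List Letter)) : Set PTree :=
  {t | ∃ bs, t = .node .sq bs ∧ t.IsCompanion Q ∧ run 0 bs.word = some 0}

/-- The class of triangle-rooted companion trees, possibly with defects, which give balanced
trees when attached to a lozenge. -/
def TriTrees (Q : Set (List Letter)) : Set PTree :=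
  {t | ∃ bs, t = .node (.letter .tri) bs ∧ t.IsCompanion Q ∧
    run 0 (bs.word ++ [.down]) = some 0}

/-- The triangle-rooted tree `t'` is obtained from the square-rooted tree `t` by rerooting it at
the free triangle matched with its root. -/
def Rerooted (t t' : PTree) : Prop :=
  (∃ bs bs', t = .node .sq bs ∧ t' = .node (.letter .tri) bs' ∧
    Branches.Matched (.free .sq bs) (.free (.letter .tri) bs')) ∧
  t'.necklaces = t.necklaces ∧ t.defects = t'.defects + 1

/-- If `u` is the Dyck word before the first defect and `v` the word after it, the tree rerooted at
that triangle reads `v`, `up`, `u`, where `up` marks the former root. A descent placed after this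
word closes that `up`, and the last-passage decomposition finds it again. -/
theorem exists_reroot (Q : Set (List Letter)) :
    ∃ f : PTree → PTree, Set.BijOn f {t ∈ OpenTrees Q | 0 < t.defects} (TriTrees Q) ∧
      ∀ t ∈ {t ∈ OpenTrees Q | 0 < t.defects},
        (f t).necklaces = t.necklaces ∧ t.defects = (f t).defects + 1 := by
  suffices h : ∃ f : PTree → PTree, Set.BijOn f {t ∈ OpenTrees Q | 0 < t.defects} (TriTrees Q) ∧
      ∀ t ∈ {t ∈ OpenTrees Q | 0 < t.defects}, Rerooted t (f t) by
    obtain ⟨f, hf, hR⟩ := h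
    exact ⟨f, hf, fun t ht => (hR t ht).2⟩
  refine exists_bijOn_of_rel Rerooted ?_ ?_ ?_ ?_
  · rintro _ ⟨⟨bs, rfl, hc, hr⟩, hd⟩
    obtain ⟨u, v, hw, hu, hv⟩ := exists_first_flat hr
      (List.count_pos_iff.1 (by simpa [PTree.defects, PTree.word, Pearl.edgeMark] using hd))
    obtain ⟨y, hm, hy, hyw, n, hn⟩ := Branches.exists_matched_right (x := .free .sq bs)
      (u := u) (v := v) (e := .flat) rfl (by simp [Branches.word, Pearl.freeMark, hw]) hu (by simp)
    obtain ⟨bs', rfl⟩ := Branches.exists_free_tri hy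
    have hc' := ((isVertex_free_iff (Or.inl rfl)).2 hc).iterate_walk n
    rw [hn] at hc'
    replace hyw : bs'.word = v ++ .up :: u := by
      simpa [Branches.word, Pearl.freeMark] using hyw
    refine ⟨.node (.letter .tri) bs', ⟨bs', rfl, (isVertex_free_iff (Or.inr rfl)).1 hc'.1,
      run_eq_zero_iff_of_down.2 ⟨v, u, hyw, hv, hu⟩⟩, ⟨bs, bs', rfl, rfl, hm⟩, hc'.2, ?_⟩
    simp [PTree.defects, PTree.word, Pearl.edgeMark, hw, hyw]
    ring
  · rintro _ ⟨bs', rfl, hc, hr⟩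
    obtain ⟨v, u, hw, hv, hu⟩ := run_eq_zero_iff_of_down.1 hr
    obtain ⟨x, hm, hx, hxw, n, hn⟩ := Branches.exists_matched_left
      (y := .free (.letter .tri) bs') (u := u) (v := v) (e := .flat) rfl
      (by simp [Branches.word, Pearl.freeMark, hw]) hu (by simp)
    obtain ⟨bs, rfl⟩ := Branches.exists_free_sq hx
    have hc' := ((isVertex_free_iff (Or.inr rfl)).2 hc).iterate_walk n
    rw [hn] at hc'
    replace hxw : bs.word = u ++ .flat :: v := by
      simpa [Branches.word, Pearl.freeMark] using hxw
    have hd : (PTree.node .sq bs).defects = (PTree.node (.letter .tri) bs').defects + 1 := by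
      simp [PTree.defects, PTree.word, Pearl.edgeMark, hw, hxw]
      ring
    refine ⟨.node .sq bs, ⟨⟨bs, rfl, (isVertex_free_iff (Or.inl rfl)).1 hc'.1, ?_⟩, by omega⟩,
      ⟨bs, bs', rfl, rfl, hm⟩, hc'.2.symm, hd⟩
    simp [hxw, run_append, hu.1, run, hv]
  · rintro _ _ _ ⟨⟨bs, bs', rfl, rfl, hm⟩, -⟩ ⟨⟨_, bs'', h, rfl, hm'⟩, -⟩
    cases h
    cases hm.right_unique hm'
    rfl
  · rintro _ _ _ ⟨⟨bs, bs', rfl, rfl, hm⟩, -⟩ ⟨⟨_, bs'', rfl, h, hm'⟩, -⟩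
    cases h
    cases hm.left_unique hm'
    rfl

/-! ### Unbalanced trees -/

theorem Branches.noDefect_iff {Q : Set (List Letter)} {b : Branches} (h : b.IsCompanion Q) :
    b.NoDefect ↔ Mark.flat ∉ b.word := by
  induction b using Branches.ind with
  | nil => simp [Branches.NoDefect, Branches.word]
  | free p bs ih =>
    obtain ⟨rfl | rfl, h⟩ := h <;>
      simp [Branches.NoDefect, Branches.word, Pearl.freeMark, ih h]
  | edge p q bs' bs ih' ih =>
    have he (p : Pearl) : Mark.flat ∉ p.edgeMark := by
      rcases p with _ | _ | _ | _ <;> simp [Pearl.edgeMark]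
    simp [Branches.NoDefect, PTree.NoDefect, Branches.word, PTree.word, ih h.2.2, ih' h.2.1.2, he]

-- Comparison with the inverse closure

/-- The mark at a half-edge. -/
def markOfStep : DyckStep → Mark
  | .U => .down
  | .D => .up

theorem Branches.word_eq_of_noDefect {Q : Set (List Letter)} {b : Branches}
    (h : b.IsCompanion Q) (hd : b.NoDefect) :
    b.word = (b.halfEdges.map markOfStep).reverse := by
  induction b using Branches.ind with
  | nil => rfl
  | free p bs ih =>
    obtain ⟨rfl | rfl, h⟩ := h
    · simp [Branches.word, Pearl.freeMark, Branches.halfEdges, markOfStep, ih h hd.2]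
    · exact absurd rfl hd.1
  | edge p q bs' bs ih' ih =>
    have he (p : Pearl) : p.edgeMark =
        ((if p = .letter .loz then [DyckStep.U] else []).map markOfStep).reverse := by
      rcases p with _ | _ | _ | _ <;> simp [Pearl.edgeMark, markOfStep]
    simp [Branches.word, PTree.word, Branches.halfEdges, PTree.halfEdges, ih h.2.2 hd.2,
      ih' h.2.1.2 hd.1, he]

theorem isDyck_iff_count {w : List Mark} (hw : Mark.flat ∉ w) :
    IsDyck w ↔ w.count .up = w.count .down ∧
      ∀ u, u <+: w → u.count .down ≤ u.count .up := by
  have hrise (w : List Mark) : rise w = w.count .up - w.count .down := by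
    induction w with
    | nil => rfl
    | cons e w ih => cases e <;> simp [rise, ih] <;> ring
  constructor
  · rintro ⟨h, -⟩
    have := eq_of_run_eq_some h
    rw [hrise] at this
    refine ⟨by omega, ?_⟩
    rintro u ⟨v, rfl⟩
    rw [run_append] at h
    cases hu : run 0 u with
    | none => simp [hu] at h
    | some j =>
      have := eq_of_run_eq_some hu
      rw [hrise] at this
      omega
  · rintro ⟨h, hp⟩
    cases hr : run 0 w with
    | none =>
      obtain ⟨u, v, rfl, hu⟩ := exists_first_down hw hr
      have h1 := hp (u ++ [.down]) ⟨v, by simp⟩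
      have h2 := eq_of_run_eq_some hu.1
      rw [hrise] at h2
      simp at h1
      omega
    | some j =>
      have := eq_of_run_eq_some hr
      rw [hrise] at this
      obtain rfl : j = 0 := by omega
      exact ⟨hr, hw⟩

/-- Reversing a word while exchanging rises and descents preserves Dyck words: prefix conditions
turn into suffix conditions, equivalent to them when the total is 0. -/
theorem isDyck_reverse_map_iff {l : List DyckStep} :
    IsDyck (l.map markOfStep).reverse ↔ ∃ d : DyckWord, d.toList = l := by
  have hinj : Function.Injective markOfStep := by
    rintro (_ | _) (_ | _) <;> simp [markOfStep]
  have hU (l : List DyckStep) : (l.map markOfStep).count .down = l.count .U :=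
    List.count_map_of_injective l markOfStep hinj .U
  have hD (l : List DyckStep) : (l.map markOfStep).count .up = l.count .D :=
    List.count_map_of_injective l markOfStep hinj .D
  rw [isDyck_iff_count (by
    simp only [List.mem_reverse, List.mem_map, not_exists]
    rintro (_ | _) <;> simp [markOfStep])]
  simp only [List.count_reverse, hU, hD]
  constructor
  · rintro ⟨h, hp⟩
    refine ⟨⟨l, h.symm, fun i => ?_⟩, rfl⟩
    have := hp ((l.drop i).map markOfStep).reverse
      (by rw [List.reverse_prefix]; exact (List.drop_suffix i l).map _)
    simp only [List.count_reverse, hU, hD] at this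
    have h1 := congrArg (List.count DyckStep.U) (List.take_append_drop i l)
    have h2 := congrArg (List.count DyckStep.D) (List.take_append_drop i l)
    rw [List.count_append] at h1 h2
    omega
  · rintro ⟨d, rfl⟩
    refine ⟨d.count_U_eq_count_D.symm, fun u hu => ?_⟩
    rw [← List.reverse_suffix, List.reverse_reverse, List.suffix_iff_eq_drop, ← List.map_drop] at hu
    generalize (d.toList.map markOfStep).length - _ = i at hu
    have h1 := hU (d.toList.drop i)
    have h2 := hD (d.toList.drop i)
    rw [← hu, List.count_reverse] at h1 h2
    have h3 := congrArg (List.count DyckStep.U) (List.take_append_drop i d.toList)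
    have h4 := congrArg (List.count DyckStep.D) (List.take_append_drop i d.toList)
    rw [List.count_append] at h3 h4
    have h5 := d.count_D_le_count_U i
    have h6 := d.count_U_eq_count_D
    omega

/-- The root's half-edge opens the contour, so its partner can reach it only by wrapping around: the
Dyck word between them is the end of the counterclockwise contour, that is, the start of the
clockwise word. -/
theorem balanced_iff {Q : Set (List Letter)} {bs : Branches}
    (h : (PTree.node .sq bs).IsCompanion Q) (hd : bs.NoDefect) :
    (PTree.node .sq bs).Balanced ↔ ¬ ∃ u v, bs.word = u ++ .down :: v ∧ IsDyck u := by
  rw [PTree.Balanced, ← not_exists, not_iff_not, Branches.word_eq_of_noDefect h.2 hd,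
    PTree.contour]
  generalize bs.halfEdges = w
  constructor
  · rintro ⟨i, hi, d, c, hr, h0⟩
    have hl := congrArg List.length hr
    simp only [List.length_rotate, List.length_cons, List.length_append] at hl hi h0
    -- Both `i` and `d.toList.length + 1` are less than the length of the contour, so their sum, a
    -- positive multiple of that length, equals it.
    have hi' : i + d.toList.length + 1 = w.length + 1 := by
      obtain ⟨k, hk⟩ := Nat.dvd_of_mod_eq_zero h0.symm
      obtain rfl : k = 1 := by
        have h1 : 0 < k := Nat.pos_of_ne_zero (by rintro rfl; omega)
        have h2 : k < 2 := by
          by_contra h2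
          have : (w.length + 1) * 2 ≤ (w.length + 1) * k := Nat.mul_le_mul_left _ (by omega)
          omega
        omega
      omega
    rw [List.rotate_eq_drop_append_take (by simpa using hi.le), ← List.cons_append] at hr
    have hw := (List.append_inj hr (by simp; omega)).1
    cases i with
    -- Position 0 carries the incoming half-edge of the root and cannot be the outgoing end.
    | zero => simp at hw
    | succ i =>
      rw [List.drop_succ_cons] at hw
      refine ⟨(d.toList.map markOfStep).reverse, ((w.take i).map markOfStep).reverse, ?_,
        isDyck_reverse_map_iff.2 ⟨d, rfl⟩⟩
      conv_lhs => rw [← List.take_append_drop i w, hw]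
      simp [markOfStep]
  · rintro ⟨u, v, hw, hu⟩
    rw [List.reverse_eq_iff, List.reverse_append, List.reverse_cons, List.append_assoc,
      List.map_eq_append_iff] at hw
    obtain ⟨l₁, l₂, rfl, -, hw⟩ := hw
    obtain ⟨s, l, rfl, hs, hl⟩ := List.map_eq_cons_iff.1 hw
    obtain rfl : s = .U := by cases s <;> simp_all [markOfStep]
    replace hl : (l.map markOfStep).reverse = u := List.reverse_eq_iff.2 hl
    rw [← hl, isDyck_reverse_map_iff] at hu
    obtain ⟨d, rfl⟩ := hu
    refine ⟨l₁.length + 1, by simp, d, l₁, ?_, ?_⟩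
    · rw [← List.cons_append]
      simp
    · have : l₁.length + 1 + d.toList.length + 1 =
          (DyckStep.D :: (l₁ ++ .U :: d.toList)).length := by
        simp; omega
      rw [this, Nat.mod_self]

theorem mem_C_sq_iff {Q : Set (List Letter)} {t : PTree} :
    t ∈ C Q .sq ↔ ∃ bs, t = .node .sq bs ∧ t.IsCompanion Q ∧ Mark.flat ∉ bs.word := by
  obtain ⟨p, bs⟩ := t
  constructor
  · rintro ⟨hc, hd, rfl⟩
    exact ⟨bs, rfl, hc, (Branches.noDefect_iff hc.2).1 hd⟩
  · rintro ⟨_, h, hc, hd⟩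
    cases h
    exact ⟨hc, (Branches.noDefect_iff hc.2).2 hd, rfl⟩

theorem mem_C_letter_iff {Q : Set (List Letter)} {a : Letter} {bs : Branches} :
    .node (.letter a) bs ∈ C Q (.letter a) ↔
      (PTree.node (.letter a) bs).IsCompanion Q ∧ Mark.flat ∉ bs.word := by
  constructor
  · rintro ⟨hc, hd, -⟩
    exact ⟨hc, (Branches.noDefect_iff hc.2).1 hd⟩
  · rintro ⟨hc, hd⟩
    exact ⟨hc, (Branches.noDefect_iff hc.2).2 hd, rfl⟩

/-- Without defects the run can fail only at a first descent below 0; if it survives, the gain 0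
forces it to end at 0. -/
theorem C_sq_balanced_iff {Q : Set (List Letter)} {bs : Branches} (h : .node .sq bs ∈ C Q .sq) :
    (PTree.node .sq bs).Balanced ↔ run 0 bs.word = some 0 := by
  obtain ⟨hc, hd, -⟩ := h
  rw [balanced_iff hc hd]
  constructor
  · intro h
    cases hr : run 0 bs.word with
    | none => exact absurd (exists_first_down ((Branches.noDefect_iff hc.2).1 hd) hr) h
    | some j =>
      have := eq_of_run_eq_some hr
      simpa [rise_word_of_sq hc] using this
  · rintro hr ⟨u, v, hw, hu⟩
    rw [hw, run_append, hu.1] at hr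
    simp [run] at hr

theorem B₀_eq (Q : Set (List Letter)) : B₀ Q = {t ∈ OpenTrees Q | t.defects = 0} := by
  ext t
  constructor
  · rintro ⟨ht, hb⟩
    obtain ⟨bs, rfl, hc, hd⟩ := mem_C_sq_iff.1 ht
    refine ⟨⟨bs, rfl, hc, (C_sq_balanced_iff ht).1 hb⟩, ?_⟩
    simpa [PTree.defects, PTree.word, Pearl.edgeMark, List.count_eq_zero] using hd
  · rintro ⟨⟨bs, rfl, hc, hr⟩, hd⟩
    have ht := mem_C_sq_iff.2 ⟨bs, rfl, hc,
      by simpa [PTree.defects, PTree.word, Pearl.edgeMark, List.count_eq_zero] using hd⟩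
    exact ⟨ht, (C_sq_balanced_iff ht).2 hr⟩

-- Cutting and gluing along a blue edge

/-- The pair `s` is obtained from the square-rooted tree `t` by cutting the edge of the lozenge
matched with its root. -/
def CutAtRoot (t : PTree) (s : PTree × PTree) : Prop :=
  (∃ bs b b', t = .node .sq bs ∧ s = (.node (.letter .loz) b', .node (.letter .tri) b) ∧
    Branches.Matched (.free .sq bs) (.edge (.letter .tri) (.node (.letter .loz) b') b)) ∧
  s.1.necklaces + s.2.necklaces = t.necklaces

theorem Branches.isVertex_edge_iff {Q : Set (List Letter)} {b b' : Branches} :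
    (Branches.edge (.letter .tri) (.node (.letter .loz) b') b).IsVertex Q ↔
      (PTree.node (.letter .loz) b').IsCompanion Q ∧
        (PTree.node (.letter .tri) b).IsCompanion Q := by
  simp only [Branches.IsVertex, Branches.IsCompanion, PTree.IsCompanion, Branches.pearls,
    Pearl.Joins, PTree.root]
  tauto

theorem Branches.allNecklaces_edge (p q : Pearl) (b b' : Branches) :
    (Branches.edge p (.node q b') b).allNecklaces =
      (PTree.node q b').necklaces + (PTree.node p b).necklaces := by
  simp only [Branches.allNecklaces, Branches.pearls, Branches.necklaces, PTree.necklaces]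
  abel

theorem exists_cutAtRoot (Q : Set (List Letter)) :
    ∃ f : PTree → PTree × PTree, Set.BijOn f {t ∈ C Q .sq | ¬ t.Balanced}
        (C Q (.letter .loz) ×ˢ C Q (.letter .tri)) ∧
      ∀ t ∈ {t ∈ C Q .sq | ¬ t.Balanced}, CutAtRoot t (f t) := by
  refine exists_bijOn_of_rel CutAtRoot ?_ ?_ ?_ ?_
  · rintro t ⟨ht, hb⟩
    obtain ⟨bs, rfl, hc, hd⟩ := mem_C_sq_iff.1 ht
    rw [balanced_iff hc ht.2.1, not_not] at hb
    obtain ⟨u, v, hw, hu⟩ := hb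
    obtain ⟨y, hm, hy, hyw, n, hn⟩ := Branches.exists_matched_right (x := .free .sq bs)
      (u := u) (v := v) (e := .down) rfl (by simp [Branches.word, Pearl.freeMark, hw]) hu (by simp)
    have hc' := ((isVertex_free_iff (Or.inl rfl)).2 hc).iterate_walk n
    rw [hn] at hc'
    obtain ⟨b, b', rfl⟩ := hc'.1.exists_edge_tri hy
    have h1 := Branches.isVertex_edge_iff.1 hc'.1
    have h2 : Mark.flat ∉ b'.word ++ b.word := by
      have : b'.word ++ b.word = v ++ .up :: u := by
        simpa [Branches.word, PTree.word, Pearl.edgeMark] using hyw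
      rw [hw] at hd
      simp_all
    rw [List.mem_append, not_or] at h2
    exact ⟨(.node (.letter .loz) b', .node (.letter .tri) b),
      ⟨mem_C_letter_iff.2 ⟨h1.1, h2.1⟩, mem_C_letter_iff.2 ⟨h1.2, h2.2⟩⟩,
      ⟨bs, b, b', rfl, rfl, hm⟩, (Branches.allNecklaces_edge ..).symm.trans hc'.2⟩
  · rintro ⟨⟨p, b'⟩, ⟨q, b⟩⟩ ⟨h', h⟩
    obtain rfl : p = .letter .loz := h'.2.2
    obtain rfl : q = .letter .tri := h.2.2
    rw [mem_C_letter_iff] at h h'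
    have hn : Mark.flat ∉ b'.word ++ b.word := by simp [h.2, h'.2]
    -- Each of the two letter-rooted trees gains 1, so the glued lozenge has a matching square.
    obtain ⟨v, u, hw, hu⟩ := exists_last_up_of_rise_pos hn
      (by rw [rise_append, rise_word_of_letter h.1, rise_word_of_letter h'.1]; norm_num)
    obtain ⟨x, hm, hx, hxw, n, hx'⟩ := Branches.exists_matched_left
      (y := .edge (.letter .tri) (.node (.letter .loz) b') b) (u := u) (v := v) (e := .down) rfl
      (by simp [Branches.word, PTree.word, Pearl.edgeMark, ← hw]) hu (by simp)
    obtain ⟨bs, rfl⟩ := Branches.exists_free_sq hx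
    have hc' := (Branches.isVertex_edge_iff.2 ⟨h'.1, h.1⟩).iterate_walk n
    rw [hx'] at hc'
    replace hxw : bs.word = u ++ .down :: v := by
      simpa [Branches.word, Pearl.freeMark] using hxw
    have hc := (isVertex_free_iff (Or.inl rfl)).1 hc'.1
    have ht := mem_C_sq_iff.2 ⟨bs, rfl, hc, by rw [hw] at hn; rw [hxw]; simp_all⟩
    exact ⟨.node .sq bs, ⟨ht, by rw [balanced_iff hc ht.2.1, not_not]; exact ⟨u, v, hxw, hu⟩⟩,
      ⟨bs, b, b', rfl, rfl, hm⟩, (Branches.allNecklaces_edge ..).symm.trans hc'.2.symm⟩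
  · rintro _ _ _ ⟨⟨bs, b, b', rfl, rfl, hm⟩, -⟩ ⟨⟨_, _, _, h, rfl, hm'⟩, -⟩
    cases h
    cases hm.right_unique hm'
    rfl
  · rintro _ _ _ ⟨⟨bs, b, b', rfl, rfl, hm⟩, -⟩ ⟨⟨_, _, _, rfl, h, hm'⟩, -⟩
    cases h
    cases hm.left_unique hm'
    rfl

/-! ### From non-negative trees to companion trees -/

/-- The conditions on the branches at the root of a tree of `OpenTrees`. -/
def Branches.IsOpen (Q : Set (List Letter)) (bs : Branches) : Prop :=
  bs.IsCompanion Q ∧ .sq ∉ bs.pearls ∧ run 0 bs.word = some 0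

theorem mem_openTrees_iff {Q : Set (List Letter)} {bs : Branches} :
    .node .sq bs ∈ OpenTrees Q ↔ IsNecklaceOf Q (.sq :: bs.pearls) ∧ bs.IsOpen Q := by
  constructor
  · rintro ⟨_, h, hc, hr⟩
    cases h
    refine ⟨hc.1, hc.2, ?_, hr⟩
    simpa [List.count_eq_zero] using hc.1.1
  · rintro ⟨hn, hc, -, hr⟩
    exact ⟨bs, rfl, ⟨hn, hc⟩, hr⟩

namespace Branches

variable {Q : Set (List Letter)} {p : Pearl} {t : PTree} {bs : Branches}

theorem isOpen_free_iff :
    (free p bs).IsOpen Q ↔ p = .letter .tri ∧ bs.IsOpen Q := by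
  rcases p with _ | _ | _ | _ <;>
    simp [IsOpen, IsCompanion, pearls, word, Pearl.freeMark, run]

theorem isOpen_edge_bul_iff :
    (edge (.letter .bul) t bs).IsOpen Q ↔ t ∈ OpenTrees Q ∧ bs.IsOpen Q := by
  obtain ⟨q, b⟩ := t
  constructor
  · rintro ⟨⟨hj, ht, hc⟩, hs, hr⟩
    obtain rfl : q = .sq := by simpa [Pearl.Joins, PTree.root] using hj
    have hw : (edge (.letter .bul) (.node .sq b) bs).word = b.word ++ bs.word := by
      simp [word, PTree.word, Pearl.edgeMark]
    rw [hw, run_append_eq_zero_iff (rise_word_of_sq ht)] at hr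
    exact ⟨⟨b, rfl, ht, hr.1⟩, hc, by simpa [pearls] using hs, hr.2⟩
  · rintro ⟨⟨b, h, ht, hr⟩, hc, hs, hr'⟩
    cases h
    refine ⟨⟨by simp [Pearl.Joins, PTree.root], ht, hc⟩, by simpa [pearls] using hs, ?_⟩
    simp [word, PTree.word, Pearl.edgeMark, run_append, hr, hr']

theorem isOpen_edge_loz_iff :
    (edge (.letter .loz) t bs).IsOpen Q ↔ t ∈ TriTrees Q ∧ bs.IsOpen Q := by
  obtain ⟨q, b⟩ := t
  constructor
  · rintro ⟨⟨hj, ht, hc⟩, hs, hr⟩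
    obtain rfl : q = .letter .tri := by simpa [Pearl.Joins, PTree.root] using hj
    have hw : (edge (.letter .loz) (.node (.letter .tri) b) bs).word =
        (b.word ++ [.down]) ++ bs.word := by
      simp [word, PTree.word, Pearl.edgeMark]
    rw [hw, run_append_eq_zero_iff (by simp [rise_append, rise_word_of_letter ht, rise])] at hr
    exact ⟨⟨b, rfl, ht, hr.1⟩, hc, by simpa [pearls] using hs, hr.2⟩
  · rintro ⟨⟨b, h, ht, hr⟩, hc, hs, hr'⟩
    cases h
    refine ⟨⟨by simp [Pearl.Joins, PTree.root], ht, hc⟩, by simpa [pearls] using hs, ?_⟩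
    have hw : (edge (.letter .loz) (.node (.letter .tri) b) bs).word =
        (b.word ++ [.down]) ++ bs.word := by
      simp [word, PTree.word, Pearl.edgeMark]
    rw [hw, run_append, hr]
    exact hr'

/-- A triangle with an edge would lead to a lozenge, whose descent is the first mark read and
already fails at height 0. -/
theorem IsOpen.of_edge (h : (edge p t bs).IsOpen Q) :
    p = .letter .bul ∨ p = .letter .loz := by
  obtain ⟨q, b⟩ := t
  obtain ⟨⟨hj, -⟩, hs, hr⟩ := h
  rcases p with _ | _ | _ | _
  · simp [pearls] at hs
  · simp
  · simp
  · obtain rfl : q = .letter .loz := by simpa [Pearl.Joins, PTree.root] using hj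
    simp [word, PTree.word, Pearl.edgeMark, run] at hr

end Branches

-- Rewiring from the leaves upwards

mutual

/-- Apply `ρ` successively to the subtrees carried by lozenges, starting from the leaves. -/
def PTree.rewire (ρ : PTree → PTree) : PTree → PTree
  | .node p bs => .node p (bs.rewire ρ)

/-- Apply `ρ` successively to the subtrees carried by lozenges, starting from the leaves. -/
def Branches.rewire (ρ : PTree → PTree) : Branches → Branches
  | .nil => .nil
  | .free p bs => .free p (bs.rewire ρ)
  | .edge p t bs => .edge p (if p = .letter .loz then ρ (t.rewire ρ) else t.rewire ρ)
      (bs.rewire ρ)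

end

section rewire

variable {Q : Set (List Letter)} {ρ : PTree → PTree}

theorem Branches.pearls_rewire (bs : Branches) : (bs.rewire ρ).pearls = bs.pearls := by
  induction bs using Branches.ind <;> simp_all [Branches.rewire, Branches.pearls]

theorem Branches.count_word_edge {p : Pearl} {t : PTree} {bs : Branches} :
    (Branches.edge p t bs).word.count .flat = t.defects + bs.word.count .flat := by
  have he : Mark.flat ∉ p.edgeMark := by rcases p with _ | _ | _ | _ <;> simp [Pearl.edgeMark]
  simp [Branches.word, PTree.defects, List.count_eq_zero.2 he]

theorem PTree.defects_node_sq (bs : Branches) :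
    (PTree.node .sq bs).defects = bs.word.count .flat := by
  simp [PTree.defects, PTree.word, Pearl.edgeMark]

variable (hρ : Set.BijOn ρ {t ∈ OpenTrees Q | 0 < t.defects} (TriTrees Q))
  (hρ' : ∀ t ∈ {t ∈ OpenTrees Q | 0 < t.defects},
    (ρ t).necklaces = t.necklaces ∧ t.defects = (ρ t).defects + 1)

include hρ hρ'

/-- Openness and the equality of excess and defect count are proved together: the excess at a
lozenge is one less than the defect count of the rewired subtree, so non-negativity there supplies
the defect that `ρ` consumes. -/
theorem Branches.rewire_spec {bs : Branches} (hq : bs.IsQTree Q) (hn : bs.NonNeg) :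
    (bs.rewire ρ).IsOpen Q ∧ (bs.rewire ρ).necklaces = bs.necklaces ∧
      ((bs.rewire ρ).word.count .flat : ℤ) = bs.excess := by
  induction bs using Branches.ind with
  | nil => simp [Branches.rewire, Branches.IsOpen, Branches.IsCompanion, Branches.pearls,
      Branches.word, run, Branches.excess]
  | free p bs ih =>
    obtain ⟨rfl, hq⟩ := hq
    obtain ⟨h1, h2, h3⟩ := ih hq hn.2
    refine ⟨Branches.isOpen_free_iff.2 ⟨rfl, h1⟩, h2, ?_⟩
    simp [Branches.rewire, Branches.word, Pearl.freeMark, Branches.excess, Pearl.excess, ← h3]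
    ring
  | edge p q b bs ihb ih =>
    obtain ⟨hp, ⟨rfl, hk, hqb⟩, hq⟩ := hq
    obtain ⟨he, ⟨het, hnb⟩, hn⟩ := hn
    obtain ⟨h1, h2, h3⟩ := ih hq hn
    obtain ⟨hb1, hb2, hb3⟩ := ihb hqb hnb
    have ht : PTree.node .sq (b.rewire ρ) ∈ OpenTrees Q :=
      mem_openTrees_iff.2 ⟨by rwa [Branches.pearls_rewire], hb1⟩
    have htn : (PTree.node .sq (b.rewire ρ)).necklaces = (PTree.node .sq b).necklaces := by
      simp [PTree.necklaces, Branches.pearls_rewire, hb2]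
    rcases hp with rfl | rfl
    · refine ⟨Branches.isOpen_edge_bul_iff.2 ⟨ht, h1⟩, ?_, ?_⟩
      · simp [Branches.rewire, Branches.necklaces, PTree.rewire, htn, h2]
      · simp [Branches.rewire, Branches.count_word_edge, PTree.rewire, PTree.defects_node_sq,
          Branches.excess, PTree.excess, Pearl.excess, h3, hb3]
    · have hd : (PTree.node .sq (b.rewire ρ)).defects = b.excess := by
        rw [PTree.defects_node_sq, hb3]
      have hpos : PTree.node .sq (b.rewire ρ) ∈ {t ∈ OpenTrees Q | 0 < t.defects} := by
        refine ⟨ht, ?_⟩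
        simp [Pearl.excess, PTree.excess] at he
        omega
      obtain ⟨hr1, hr2⟩ := hρ' _ hpos
      refine ⟨Branches.isOpen_edge_loz_iff.2 ⟨hρ.mapsTo hpos, h1⟩, ?_, ?_⟩
      · simp [Branches.rewire, Branches.necklaces, PTree.rewire, hr1, htn, h2]
      · simp [Branches.rewire, Branches.count_word_edge, PTree.rewire,
          Branches.excess, PTree.excess, Pearl.excess, h3]
        omega

theorem PTree.rewire_spec {t : PTree} (hq : t.IsQTree Q) (hn : t.NonNeg) :
    t.rewire ρ ∈ OpenTrees Q ∧ (t.rewire ρ).necklaces = t.necklaces ∧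
      ((t.rewire ρ).defects : ℤ) = t.excess := by
  obtain ⟨p, bs⟩ := t
  obtain ⟨rfl, hk, hq⟩ := hq
  obtain ⟨h1, h2, h3⟩ := Branches.rewire_spec hρ hρ' hq hn.2
  refine ⟨mem_openTrees_iff.2 ⟨by rwa [Branches.pearls_rewire], h1⟩, ?_, ?_⟩
  · simp [PTree.rewire, PTree.necklaces, Branches.pearls_rewire, h2]
  · simp [PTree.rewire, PTree.defects_node_sq, PTree.excess, Pearl.excess, h3]

theorem Branches.rewire_injective {bs bs' : Branches} (hq : bs.IsQTree Q) (hn : bs.NonNeg)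
    (hq' : bs'.IsQTree Q) (hn' : bs'.NonNeg) (h : bs.rewire ρ = bs'.rewire ρ) : bs = bs' := by
  induction bs using Branches.ind generalizing bs' with
  | nil => cases bs' <;> simp [Branches.rewire] at h ⊢
  | free p bs ih =>
    cases bs' <;> simp [Branches.rewire] at h ⊢
    exact ⟨h.1, ih hq.2 hn.2 hq'.2 hn'.2 h.2⟩
  | edge p q b bs ihb ih =>
    rcases bs' with _ | _ | ⟨p', ⟨q', b'⟩, bs'⟩ <;> simp [Branches.rewire] at h ⊢
    obtain ⟨rfl, h1, h2⟩ := h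
    refine ⟨rfl, ?_, ih hq.2.2 hn.2.2 hq'.2.2 hn'.2.2 h2⟩
    have h3 : (PTree.node q b).rewire ρ = (PTree.node q' b').rewire ρ := by
      split_ifs at h1 with hp
      · subst hp
        have key {t : PTree} (hq : t.IsQTree Q) (hn : t.NonNeg)
            (he : 0 ≤ Pearl.excess (.letter .loz) + t.excess) :
            t.rewire ρ ∈ {t ∈ OpenTrees Q | 0 < t.defects} := by
          obtain ⟨h1, -, h3⟩ := PTree.rewire_spec hρ hρ' hq hn
          refine ⟨h1, ?_⟩
          simp [Pearl.excess] at he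
          omega
        exact hρ.injOn (key hq.2.1 hn.2.1 hn.1) (key hq'.2.1 hn'.2.1 hn'.1) h1
      · exact h1
    simp only [PTree.rewire, PTree.node.injEq] at h3 ⊢
    exact ⟨h3.1, ihb hq.2.1.2.2 hn.2.1.2 hq'.2.1.2.2 hn'.2.1.2 h3.2⟩

/-- Undoing `ρ` changes the shape of a subtree, so structural induction alone does not suffice. The
number of vertices is preserved, and serves as the outer induction parameter. -/
theorem Branches.rewire_surjective (n : ℕ) {bs : Branches} (hs : bs.necklaces.card ≤ n)
    (ho : bs.IsOpen Q) : ∃ b : Branches, b.IsQTree Q ∧ b.NonNeg ∧ b.rewire ρ = bs := by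
  induction n using Nat.strong_induction_on generalizing bs with
  | _ n ihn =>
  -- Removing the root vertex lowers the count strictly, so the outer hypothesis covers a whole
  -- tree, even one just rerooted.
  have key {t : PTree} (ht : t ∈ OpenTrees Q) (hs : t.necklaces.card ≤ n) :
      ∃ s : PTree, s.IsQTree Q ∧ s.NonNeg ∧ s.rewire ρ = t := by
    obtain ⟨b, rfl, -⟩ := id ht
    obtain ⟨h1, h2⟩ := mem_openTrees_iff.1 ht
    have hlt : b.necklaces.card < n := by
      simp [PTree.necklaces] at hs
      omega
    obtain ⟨b', hq, hn, rfl⟩ := ihn _ hlt le_rfl h2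
    rw [Branches.pearls_rewire] at h1
    refine ⟨.node .sq b', ⟨rfl, h1, hq⟩, ⟨?_, hn⟩, rfl⟩
    have := (Branches.rewire_spec hρ hρ' hq hn).2.2
    simp only [PTree.excess, Pearl.excess]
    omega
  induction bs using Branches.ind with
  | nil => exact ⟨.nil, trivial, trivial, rfl⟩
  | free p bs ih =>
    obtain ⟨rfl, ho'⟩ := Branches.isOpen_free_iff.1 ho
    obtain ⟨b, hq, hn, rfl⟩ := ih hs ho'
    exact ⟨.free (.letter .tri) b, ⟨rfl, hq⟩, ⟨by simp [Pearl.excess], hn⟩, rfl⟩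
  | edge p q b bs _ ih =>
    have hs' : (PTree.node q b).necklaces.card ≤ n ∧ bs.necklaces.card ≤ n := by
      simp only [Branches.necklaces, Multiset.card_add] at hs
      omega
    rcases ho.of_edge with rfl | rfl
    · obtain ⟨ht, ho⟩ := Branches.isOpen_edge_bul_iff.1 ho
      obtain ⟨b', hq, hn, rfl⟩ := ih hs'.2 ho
      obtain ⟨s, hsq, hsn, h⟩ := key ht hs'.1
      obtain ⟨-, -, h0⟩ := PTree.rewire_spec hρ hρ' hsq hsn
      refine ⟨.edge (.letter .bul) s b', ⟨Or.inl rfl, hsq, hq⟩, ⟨?_, hsn, hn⟩, ?_⟩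
      · simp only [Pearl.excess]
        omega
      · simp [Branches.rewire, h]
    · obtain ⟨ht, ho⟩ := Branches.isOpen_edge_loz_iff.1 ho
      obtain ⟨b', hq, hn, rfl⟩ := ih hs'.2 ho
      obtain ⟨t', ht', h'⟩ := hρ.surjOn ht
      obtain ⟨s, hsq, hsn, rfl⟩ := key ht'.1 (by rw [← (hρ' _ ht').1, h']; exact hs'.1)
      obtain ⟨-, -, h0⟩ := PTree.rewire_spec hρ hρ' hsq hsn
      refine ⟨.edge (.letter .loz) s b', ⟨Or.inr rfl, hsq, hq⟩, ⟨?_, hsn, hn⟩, ?_⟩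
      · have := ht'.2
        simp only [Pearl.excess]
        omega
      · simp [Branches.rewire, h']

theorem PTree.rewire_bijOn : Set.BijOn (PTree.rewire ρ) (F Q 0) (B₀ Q) := by
  rw [B₀_eq]
  refine ⟨fun t ⟨hq, hn, he⟩ => ?_, fun t ⟨hq, hn, _⟩ t' ⟨hq', hn', _⟩ h => ?_,
    fun t ⟨ht, hd⟩ => ?_⟩
  · obtain ⟨h1, -, h3⟩ := PTree.rewire_spec hρ hρ' hq hn
    exact ⟨h1, by simpa [he] using h3⟩
  · obtain ⟨p, b⟩ := t
    obtain ⟨p', b'⟩ := t'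
    simp only [PTree.rewire, PTree.node.injEq] at h ⊢
    exact ⟨h.1, Branches.rewire_injective hρ hρ' hq.2.2 hn.2 hq'.2.2 hn'.2 h.2⟩
  -- The statement about branches is applied to a single bullet carrying `t`, since a bullet leaves
  -- its subtree unrerooted.
  · have h := Branches.rewire_surjective hρ hρ' t.necklaces.card
      (bs := .edge (.letter .bul) t .nil) (by simp [Branches.necklaces])
      (Branches.isOpen_edge_bul_iff.2 ⟨ht, by
        simp [Branches.IsOpen, Branches.IsCompanion, Branches.pearls, Branches.word, run]⟩)
    obtain ⟨b, hq, hn, h⟩ := h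
    rcases b with _ | _ | ⟨p, s, b⟩ <;> simp [Branches.rewire] at h
    obtain ⟨rfl, h, -⟩ := h
    simp only [Pearl.letter.injEq, reduceCtorEq, if_false] at h
    obtain ⟨-, -, h3⟩ := PTree.rewire_spec hρ hρ' hq.2.1 hn.2.1
    exact ⟨s, ⟨hq.2.1, hn.2.1, by rw [← h3, h, hd]⟩, h⟩

end rewire

theorem exists_bijOn_B₀ (Q : Set (List Letter)) :
    ∃ f : PTree → PTree, Set.BijOn f (F Q 0) (B₀ Q) ∧
      ∀ t ∈ F Q 0, (f t).necklaces = t.necklaces := by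
  obtain ⟨ρ, h, h'⟩ := exists_reroot Q
  exact ⟨PTree.rewire ρ, PTree.rewire_bijOn h h', fun t ht =>
    (PTree.rewire_spec h h' ht.1 ht.2.1).2.1⟩

/-! ### Finiteness -/

instance : Finite Letter :=
  Finite.of_injective (fun a : Letter => (decide (a = .bul), decide (a = .loz)))
    (by intro a b; cases a <;> cases b <;> simp)

instance : Finite Pearl :=
  Finite.of_injective Pearl.letter? (by intro a b; cases a <;> cases b <;> simp [Pearl.letter?])

theorem Branches.finite_steps_le (n : ℕ) : {b : Branches | b.steps ≤ n}.Finite := by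
  induction n with
  | zero =>
    refine (Set.finite_singleton Branches.nil).subset fun b hb => ?_
    exact Branches.eq_nil_of_steps_eq_zero (Nat.le_zero.1 hb)
  | succ n ih =>
    have h1 := (Set.finite_univ (α := Pearl)).prod ih
    have h2 := (Set.finite_univ (α := Pearl)).prod (h1.prod ih)
    refine (((Set.finite_singleton Branches.nil).union
      (h1.image fun x => Branches.free x.1 x.2)).union
      (h2.image fun x => Branches.edge x.1 (.node x.2.1.1 x.2.1.2) x.2.2)).subset fun b hb => ?_
    rcases b with _ | ⟨p, bs⟩ | ⟨p, ⟨q, bs'⟩, bs⟩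
    · exact Or.inl (Or.inl rfl)
    · refine Or.inl (Or.inr ⟨(p, bs), ⟨trivial, ?_⟩, rfl⟩)
      simpa [Branches.steps] using hb
    · refine Or.inr ⟨(p, (q, bs'), bs), ⟨trivial, ⟨trivial, ?_⟩, ?_⟩, rfl⟩ <;>
        simp [Branches.steps, PTree.steps] at hb ⊢ <;> omega

theorem PTree.finite_steps_le (n : ℕ) : {t : PTree | t.steps ≤ n}.Finite := by
  refine (((Set.finite_univ (α := Pearl)).prod (Branches.finite_steps_le n)).image
    fun x => PTree.node x.1 x.2).subset fun t ht => ?_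
  obtain ⟨p, bs⟩ := t
  refine ⟨(p, bs), ⟨trivial, ?_⟩, rfl⟩
  simp [PTree.steps] at ht ⊢
  omega

/-- `Q` may be infinite, so pearls must be bounded. An edge costs two steps and brings one vertex,
and the spare unit pays for the -1 of a lozenge; a free triangle costs one step and adds 1 to the
excess. -/
theorem Branches.steps_le_of_isQTree {Q : Set (List Letter)} {bs : Branches}
    (h : bs.IsQTree Q) : (bs.steps : ℤ) ≤ 3 * bs.necklaces.card + bs.excess := by
  induction bs using Branches.ind with
  | nil => simp [Branches.steps, Branches.necklaces, Branches.excess]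
  | free p bs ih =>
    obtain ⟨rfl, h⟩ := h
    have := ih h
    simp [Branches.steps, Branches.necklaces, Branches.excess, Pearl.excess]
    omega
  | edge p q b bs ihb ih =>
    obtain ⟨hp, ⟨rfl, -, hb⟩, h⟩ := h
    have := ih h
    have := ihb hb
    rcases hp with rfl | rfl <;>
    · simp [Branches.steps, PTree.steps, Branches.necklaces, PTree.necklaces, Branches.excess,
        PTree.excess, Pearl.excess]
      omega

/-- Two steps for each edge, and one for the only pearl of a vertex that may be free, its square. -/
theorem Branches.steps_le_of_noDefect {Q : Set (List Letter)} {bs : Branches}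
    (h : bs.IsCompanion Q) (hd : bs.NoDefect) :
    bs.steps ≤ 3 * bs.necklaces.card + bs.pearls.count .sq := by
  induction bs using Branches.ind with
  | nil => simp [Branches.steps]
  | free p bs ih =>
    have := ih h.2 hd.2
    obtain rfl : p = .sq := h.1.resolve_right hd.1
    simp [Branches.steps, Branches.necklaces, Branches.pearls]
    omega
  | edge p q b bs ihb ih =>
    obtain ⟨-, ⟨⟨hn, -⟩, hb⟩, h⟩ := h
    have := ih h hd.2
    have := ihb hb hd.1
    have : b.pearls.count .sq ≤ 1 := hn ▸ List.count_le_count_cons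
    have : bs.pearls.count .sq ≤ (p :: bs.pearls).count .sq := List.count_le_count_cons
    simp [Branches.steps, PTree.steps, Branches.necklaces, PTree.necklaces, Branches.pearls]
    omega

theorem finite_F (Q : Set (List Letter)) (k n : ℕ) : {t ∈ F Q k | t.size = n}.Finite := by
  refine (PTree.finite_steps_le (3 * n + k)).subset ?_
  rintro ⟨p, bs⟩ ⟨⟨⟨rfl, -, h⟩, -, he⟩, hs⟩
  have := Branches.steps_le_of_isQTree h
  simp [PTree.size, PTree.necklaces, PTree.steps, PTree.excess, Pearl.excess] at he hs ⊢
  omega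

theorem finite_C (Q : Set (List Letter)) (p : Pearl) (n : ℕ) :
    {t ∈ C Q p | t.size = n}.Finite := by
  refine (PTree.finite_steps_le (3 * n)).subset ?_
  rintro ⟨p, bs⟩ ⟨⟨⟨⟨hn, -⟩, h⟩, hd, -⟩, hs⟩
  have := Branches.steps_le_of_noDefect h hd
  have : bs.pearls.count .sq ≤ 1 := hn ▸ List.count_le_count_cons
  simp [PTree.size, PTree.necklaces, PTree.steps] at hs ⊢
  omega

/-! ### Generating functions -/

theorem gff_eq (Q : Set (List Letter)) : gff Q = gf (F Q 0) := by
  ext n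
  simp [gff, gfF, gf]

theorem card_sumNecklaces {A B B' : Set PTree} (x : A ⊕ B × B') :
    Multiset.card (sumNecklaces x) =
      Sum.elim (fun t : A => t.1.size) (fun s : B × B' => s.1.1.size + s.2.1.size) x := by
  rcases x with t | ⟨t, t'⟩ <;> simp [sumNecklaces, PTree.size]

theorem ncard_prod_size {B B' : Set PTree} (hB : ∀ n, {t ∈ B | t.size = n}.Finite)
    (hB' : ∀ n, {t ∈ B' | t.size = n}.Finite) (n : ℕ) :
    {s : PTree × PTree | s ∈ B ×ˢ B' ∧ s.1.size + s.2.size = n}.Finite ∧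
    {s : PTree × PTree | s ∈ B ×ˢ B' ∧ s.1.size + s.2.size = n}.ncard =
      ∑ ij ∈ Finset.HasAntidiagonal.antidiagonal n,
        {t ∈ B | t.size = ij.1}.ncard * {t ∈ B' | t.size = ij.2}.ncard := by
  classical
  let S (i j : ℕ) : Finset (PTree × PTree) := (hB i).toFinset ×ˢ (hB' j).toFinset
  have h : {s : PTree × PTree | s ∈ B ×ˢ B' ∧ s.1.size + s.2.size = n} =
      ((Finset.HasAntidiagonal.antidiagonal n).biUnion fun ij => S ij.1 ij.2 :
        Finset (PTree × PTree)) := by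
    ext ⟨t, t'⟩
    simp only [S, Set.mem_ofPred_eq, Set.mem_prod, Finset.coe_biUnion, Finset.mem_coe,
      Finset.HasAntidiagonal.mem_antidiagonal, Set.mem_iUnion, Finset.mem_product,
      Set.Finite.mem_toFinset]
    constructor
    · rintro ⟨⟨h, h'⟩, hn⟩
      exact ⟨(t.size, t'.size), hn, ⟨h, rfl⟩, h', rfl⟩
    · rintro ⟨⟨i, j⟩, hn, ⟨h, rfl⟩, h', rfl⟩
      exact ⟨⟨h, h'⟩, hn⟩
  rw [h]
  refine ⟨Finset.finite_toSet _, ?_⟩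
  rw [Set.ncard_coe_finset, Finset.card_biUnion]
  · refine Finset.sum_congr rfl fun ij _ => ?_
    rw [Finset.card_product, Set.ncard_eq_toFinset_card _ (hB _),
      Set.ncard_eq_toFinset_card _ (hB' _)]
  · intro x _ y _ hxy
    rw [Function.onFun, Finset.disjoint_left]
    rintro ⟨t, t'⟩ h1 h2
    simp only [S, Finset.mem_product, Set.Finite.mem_toFinset, Set.mem_ofPred_eq] at h1 h2
    exact hxy (Prod.ext (h1.1.2.symm.trans h2.1.2) (h1.2.2.symm.trans h2.2.2))

theorem gf_eq_of_equiv {A A' B B' : Set PTree} (e : A ≃ A' ⊕ B × B')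
    (he : ∀ t, sumNecklaces (e t) = t.1.necklaces)
    (hA : ∀ n, {t ∈ A' | t.size = n}.Finite) (hB : ∀ n, {t ∈ B | t.size = n}.Finite)
    (hB' : ∀ n, {t ∈ B' | t.size = n}.Finite) : gf A = gf A' + gf B * gf B' := by
  ext n
  obtain ⟨hf, hc⟩ := ncard_prod_size hB hB' n
  have e₁ : {t : PTree // t ∈ A ∧ t.size = n} ≃
      {t : PTree // t ∈ A' ∧ t.size = n} ⊕
        {s : PTree × PTree // s ∈ B ×ˢ B' ∧ s.1.size + s.2.size = n} :=
    calc {t : PTree // t ∈ A ∧ t.size = n}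
      _ ≃ {t : A // t.1.size = n} :=
        (Equiv.subtypeSubtypeEquivSubtypeInter (· ∈ A) (fun t => t.size = n)).symm
      _ ≃ {x : A' ⊕ B × B' // Sum.elim (fun t : A' => t.1.size)
            (fun s : B × B' => s.1.1.size + s.2.1.size) x = n} :=
        e.subtypeEquiv fun t => by rw [← card_sumNecklaces, he]; rfl
      _ ≃ {t : A' // t.1.size = n} ⊕ {s : B × B' // s.1.1.size + s.2.1.size = n} :=
        Equiv.subtypeSum
      _ ≃ _ := Equiv.sumCongr
        (Equiv.subtypeSubtypeEquivSubtypeInter (· ∈ A') (fun t => t.size = n))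
        (((Equiv.Set.prod B B').symm.subtypeEquiv fun s => Iff.rfl).trans
          (Equiv.subtypeSubtypeEquivSubtypeInter (fun s => s ∈ B ×ˢ B')
            fun s => s.1.size + s.2.size = n))
  have h : {t ∈ A | t.size = n}.ncard = {t ∈ A' | t.size = n}.ncard +
      {s : PTree × PTree | s ∈ B ×ˢ B' ∧ s.1.size + s.2.size = n}.ncard := by
    have := (hA n).to_subtype
    have := hf.to_subtype
    rw [← Nat.card_coe_set_eq, ← Nat.card_coe_set_eq, ← Nat.card_coe_set_eq, ← Nat.card_sum]
    exact Nat.card_congr e₁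
  simp only [gf, PowerSeries.coeff_mk, map_add, PowerSeries.coeff_mul, h, hc]
  push_cast
  rfl

theorem exists_equiv_C_sq (Q : Set (List Letter)) :
    ∃ e : C Q .sq ≃ B₀ Q ⊕ C Q (.letter .loz) × C Q (.letter .tri),
      ∀ t, sumNecklaces (e t) = t.1.necklaces := by
  classical
  obtain ⟨f, hf, hR⟩ := exists_cutAtRoot Q
  obtain ⟨e₁, h₁⟩ : ∃ e₁ : B₀ Q ≃ {t : C Q .sq // t.1.Balanced}, ∀ t, (e₁ t).1.1 = t.1 :=
    ⟨(Equiv.subtypeSubtypeEquivSubtypeInter (· ∈ C Q .sq) PTree.Balanced).symm, fun _ => rfl⟩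
  obtain ⟨e₂, h₂⟩ : ∃ e₂ : {t : C Q .sq // ¬ t.1.Balanced} ≃
      C Q (.letter .loz) × C Q (.letter .tri),
      ∀ t, ((e₂ t).1.1, (e₂ t).2.1) = f t.1.1 :=
    ⟨((Equiv.subtypeSubtypeEquivSubtypeInter (· ∈ C Q .sq) (¬ PTree.Balanced ·)).trans
      (hf.equiv f)).trans (Equiv.Set.prod _ _), fun _ => rfl⟩
  refine ⟨((Equiv.sumCongr e₁ e₂.symm).trans
    (Equiv.sumCompl fun t : C Q .sq => t.1.Balanced)).symm, fun t => ?_⟩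
  by_cases ht : t.1.Balanced
  · obtain ⟨s, hs⟩ := e₁.surjective ⟨t, ht⟩
    have := h₁ s
    rw [hs] at this
    simp [Equiv.sumCompl_symm_apply_of_pos, ht, ← hs, sumNecklaces]
    exact congrArg PTree.necklaces this.symm
  · have := (hR t.1 ⟨t.2, ht⟩).2
    rw [← h₂ ⟨t, ht⟩] at this
    simpa [Equiv.sumCompl_symm_apply_of_neg, ht, sumNecklaces] using this

theorem exists_equiv_F (Q : Set (List Letter)) (β : Set PTree × Set PTree) :
    ∃ e : B₀ Q ⊕ β.1 × β.2 ≃ F Q 0 ⊕ β.1 × β.2,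
      ∀ x, sumNecklaces (e x) = sumNecklaces x := by
  obtain ⟨f, hf, h⟩ := exists_bijOn_B₀ Q
  refine ⟨Equiv.sumCongr (hf.equiv f).symm (Equiv.refl _), ?_⟩
  rintro (t | s)
  · obtain ⟨t, rfl⟩ := (hf.equiv f).surjective t
    have : sumNecklaces (.inl (hf.equiv f t) : B₀ Q ⊕ β.1 × β.2) = t.1.necklaces :=
      h t.1 t.2
    rw [this]
    simp [sumNecklaces]
  · rfl

end Necklace

theorem mainTheorem4 (Q : Set (List Necklace.Letter)) :
    -- the necklace-preserving bijections
    (∃ e : Necklace.C Q .sq ≃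
        Necklace.B₀ Q ⊕ Necklace.C Q (.letter .loz) × Necklace.C Q (.letter .tri),
      ∀ t, Necklace.sumNecklaces (e t) = t.1.necklaces) ∧
    (∃ e : Necklace.B₀ Q ⊕ Necklace.C Q (.letter .loz) × Necklace.C Q (.letter .tri) ≃
        Necklace.F Q 0 ⊕ Necklace.C Q (.letter .loz) × Necklace.C Q (.letter .tri),
      ∀ x, Necklace.sumNecklaces (e x) = Necklace.sumNecklaces x) ∧
    -- the generating functions are well defined
    (∀ k n : ℕ, {t ∈ Necklace.F Q k | t.size = n}.Finite) ∧
    (∀ p ∈ [Necklace.Pearl.sq, .letter .loz, .letter .tri], ∀ n : ℕ,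
      {t ∈ Necklace.C Q p | t.size = n}.Finite) ∧
    -- the identity between generating functions
    Necklace.gff Q = Necklace.gf (Necklace.F Q 0) ∧
    Necklace.gff Q = Necklace.gf (Necklace.C Q .sq) -
      Necklace.gf (Necklace.C Q (.letter .loz)) * Necklace.gf (Necklace.C Q (.letter .tri)) := by
  obtain ⟨e, he⟩ := Necklace.exists_equiv_C_sq Q
  obtain ⟨e', he'⟩ := Necklace.exists_equiv_F Q
    (Necklace.C Q (.letter .loz), Necklace.C Q (.letter .tri))
  refine ⟨⟨e, he⟩, ⟨e', he'⟩, Necklace.finite_F Q, fun p _ => Necklace.finite_C Q p,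
    Necklace.gff_eq Q, ?_⟩
  rw [Necklace.gff_eq, eq_sub_iff_add_eq]
  exact (Necklace.gf_eq_of_equiv (e.trans e') (fun t => (he' _).trans (he t))
    (Necklace.finite_F Q 0) (Necklace.finite_C Q _) (Necklace.finite_C Q _)).symm
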